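/- **Setting.** Let $r\ge 0$, let $\mathbf x=(x_1,\dots,x_r)$ be indeterminates, and let $D$ be a finite subset of $\mathbb C[\mathbf x,\mathbf x^{-1}]$. Fix a total order on the monomials $\mathbf x^m$ ($m\in\mathbb Z^r$) compatible with multiplication. For $z\in\mathbb C$ and $a\in\mathbb C[\mathbf x,\mathbf x^{-1}]$, the fraction $1/(z-a)$ is expanded in the field of formal Laurent series with well-ordered support, and integrals of such series are taken coefficientwise, with values in $\mathbb C[[\mathbf x,\mathbf x^{-1}]]$. A *path* on $M\subseteq\mathbb C$ is a piecewise smooth map $\gamma\colon[0,1]\to\mathbb C$ with $\gamma((0,1))\subseteq M$ that has non-zero one-sided tangent vectors $\lim_{t\searrow0}(\gamma(t)-\gamma(0))/t$ and $\lim_{t\nearrow1}(\gamma(t)-\gamma(1))/(t-1)$. Let $\gamma$ be a path on $\mathbb C\setminus(D\cup\{0\})$. Assume that for every non-constant $a\in D$ either some monomial of $a$ is smaller than $1$, or the constant term of $a$ does not lie on $\gamma([0,1])$ (so that the coefficients of $1/(\gamma(t)-a)$ have no pole along $\gamma$; this holds for $a=x_i^{-1}$ if $x_i>1$). A *$D$-colored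 rooted tree* $X=(V,E,\mathrm{rt},C)$ is a finite tree $(V,E)$ with a root $\mathrm{rt}\in V$ and a map $C\colon V\to D$. For $v\ne\mathrm{rt}$, let $p_v$ be the vertex adjacent to $v$ that is nearest to $\mathrm{rt}$. An *index* is a map $\mathbf k\colon E\to\mathbb Z_{\ge0}$; put $\mathbf k_v=\mathbf k(\{v,p_v\})$ for $v\neq\mathrm{rt}$ and $\mathbf k_{\mathrm{rt}}=1$. It is *essentially positive* if the sum of $\mathbf k$ over the path between any two distinct vertices of non-zero color is positive. $X$ is *$\gamma$-admissible* if every vertex of color $\gamma(0)$ has degree greater than $1$ and $C(\mathrm{rt})\notin\{\gamma(0),\gamma(1)\}$. The pair $(X;\mathbf k)$ is *$\gamma$-harvestable* if $X$ is $\gamma$-admissible, $\deg(\mathrm{rt})=1$, $\deg(v)\le2$ whenever $C(v)\ne0$, $\deg(v)\ne2$ whenever $C(v)=0$, and $\mathbf k_v=0$ implies $C(v)=0$ and $C(p_v)\ne0$. Let $\Delta(X;\mathbf k)$ be the set of $(t_v)_{v\in V}\in[0,1]^V$ such that, for all $v\neq\mathrm{rt}$, $t_v<t_{p_v}$ if $\mathbf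 k_v>0$ and $t_v=t_{p_v}$ if $\mathbf k_v=0$; its independent variables are the $t_v$ with $\mathbf k_v>0$. Put $$I_\gamma(X;\mathbf k)=\int_{\Delta(X;\mathbf k)}\ \prod_{\mathbf k_v>0}\frac{(\log\gamma(t_{p_v})-\log\gamma(t_v))^{\mathbf k_v-1}}{(\mathbf k_v-1)!}\frac{d\gamma(t_v)}{\gamma(t_v)-C(v)}\ \prod_{\mathbf k_v=0}\frac{\gamma(t_v)}{\gamma(t_v)-C(v)},$$ where $\log$ is a continuous branch of the logarithm along $\gamma$, and the factor of $v=\mathrm{rt}$ is $d\gamma(t_{\mathrm{rt}})/(\gamma(t_{\mathrm{rt}})-C(\mathrm{rt}))$. **Proposition.** Let $X=(V,E,\mathrm{rt},C)$ be a $\gamma$-admissible $D$-colored rooted tree and $\mathbf k$ an essentially positive index on $X$. Assume that 1. $C(\mathrm{rt})\neq0$, or $\mathrm{rt}$ has degree $1$ and its edge has positive index; 2. if $\gamma(0)=0$, then $X$ has at least two vertices; 3. if $\gamma(0)\neq0$, then for every vertex $v$ with $C(v)=\gamma(0)$ there is a vertex $w\ne\mathrm{rt}$ with $\mathbf k_w>0$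 such that $p_w$ is joined to $v$ by a (possibly empty) path of edges of index $0$. Then the integral $I_\gamma(X;\mathbf k)$ converges absolutely (coefficientwise), and there is a $\gamma$-harvestable $(D\cup\{0\})$-colored pair $(X_{\mathrm{har}};\mathbf k_{\mathrm{har}})$ whose integral also converges absolutely and satisfies $$I_\gamma(X;\mathbf k)=I_\gamma(X_{\mathrm{har}};\mathbf k_{\mathrm{har}}).$$ -/

import Mathlib

open MeasureTheory Filter Topology
open scoped ContDiff

universe u

noncomputable section

namespace TreeIntegral

/-- Laurent polynomials in the indeterminates `x_1, …, x_r` over `ℂ`. -/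
abbrev LaurentPoly (r : ℕ) : Type := AddMonoidAlgebra ℂ (Fin r → ℤ)

/-- A complex number as a constant Laurent polynomial. -/
abbrev LaurentPoly.const (r : ℕ) (z : ℂ) : LaurentPoly r := algebraMap ℂ (LaurentPoly r) z

section Expansion

variable {r : ℕ} {Γ : Type} [AddCommGroup Γ] [LinearOrder Γ] [IsOrderedAddMonoid Γ]

/-- A Laurent polynomial as a formal series. The isomorphism `mon` of `ℤ^r` with a linearly ordered
group `Γ` is a total order on the monomials `x^m`, compatible with multiplication; it fixes how the
fractions `1 / (z - a)` are expanded into Laurent series, namely in the field of series with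
well-ordered support. -/
def expand (mon : (Fin r → ℤ) ≃+ Γ) (a : LaurentPoly r) : HahnSeries Γ ℂ :=
  a.coeff.sum fun m c => HahnSeries.single (mon m) c

/-- The expansion of `1 / (z - a)` for a complex number `z`. -/
def fraction (mon : (Fin r → ℤ) ≃+ Γ) (z : ℂ) (a : LaurentPoly r) : HahnSeries Γ ℂ :=
  (HahnSeries.C z - expand mon a)⁻¹

/-- For a non-constant `a`, the coefficients of the expansion of `1 / (z - a)` are functions of `z`
whose only possible pole is the constant term of `a`, and this pole occurs exactly when no
monomial of `a` is smaller than `1`. The condition says that there is no such pole on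
`γ([0,1])`. -/
def RegularAlong (mon : (Fin r → ℤ) ≃+ Γ) (γ : ℝ → ℂ) (a : LaurentPoly r) : Prop :=
  (∃ m, mon m < 0 ∧ a.coeff m ≠ 0) ∨ ∀ t ∈ Set.Icc (0 : ℝ) 1, γ t ≠ a.coeff 0

end Expansion

section Paths

/-- A point of `ℂ` with a non-zero tangent vector. -/
structure TangentialBasePoint where
  pt : ℂ
  vec : ℂ
  vec_ne_zero : vec ≠ 0

/-- `γ` is continuous on `[0,1]` and, away from finitely many break points, smooth up to the ends of
each piece. -/
def PiecewiseSmooth (γ : ℝ → ℂ) : Prop :=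
  ContinuousOn γ (Set.Icc 0 1) ∧
    ∃ B : Finset ℝ, ∀ a b : ℝ, 0 ≤ a → a < b → b ≤ 1 → (∀ s ∈ B, s ∉ Set.Ioo a b) →
      ContDiffOn ℝ ∞ γ (Set.Icc a b)

/-- `γ`, restricted to `[0,1]`, is a path from `p` to `q` on `M`. -/
structure IsPathFromTo (γ : ℝ → ℂ) (p q : TangentialBasePoint) (M : Set ℂ) : Prop where
  piecewiseSmooth : PiecewiseSmooth γ
  source : γ 0 = p.pt
  target : γ 1 = q.pt
  tangent_source : Tendsto (fun t : ℝ => (γ t - p.pt) / (t : ℂ)) (𝓝[>] 0) (𝓝 p.vec)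
  tangent_target : Tendsto (fun t : ℝ => (γ t - q.pt) / ((t : ℂ) - 1)) (𝓝[<] 1) (𝓝 (-q.vec))
  mem : ∀ t ∈ Set.Ioo (0 : ℝ) 1, γ t ∈ M

/-- `γ` is a path on `M`, between some tangential base points. -/
def IsPathOn (γ : ℝ → ℂ) (M : Set ℂ) : Prop := ∃ p q, IsPathFromTo γ p q M

/-- `ℂ ∖ D` for a set `D` of Laurent polynomials: the complex numbers that are not in `D`. -/
def complexCompl {r : ℕ} (D : Set (LaurentPoly r)) : Set ℂ := {z | LaurentPoly.const r z ∉ D}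

/-- `log γ(t) - log γ(s)` for a continuous branch of the logarithm along `γ`. -/
def logDiff (γ : ℝ → ℂ) (s t : ℝ) : ℂ := ∫ u in s..t, deriv γ u / γ u

end Paths

/-- A `D`-colored rooted tree. -/
structure ColoredTree {r : ℕ} (D : Set (LaurentPoly r)) where
  V : Type u
  [fintypeV : Fintype V]
  graph : SimpleGraph V
  isTree : graph.IsTree
  root : V
  color : V → LaurentPoly r
  color_mem : ∀ v, color v ∈ D

attribute [instance] ColoredTree.fintypeV

namespace ColoredTree

variable {r : ℕ} {D : Set (LaurentPoly r)} (X : ColoredTree.{u} D)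

/-- The number of edges at `v`. -/
def deg (v : X.V) : ℕ := (X.graph.neighborSet v).ncard

open Classical in
/-- The parent of `v`: the adjacent vertex that is nearer to the root (and `root` for `root`). -/
def parent (v : X.V) : X.V :=
  if h : ∃ w, X.graph.Adj v w ∧ X.graph.dist w X.root < X.graph.dist v X.root then h.choose else v

/-- An index on `X`. -/
abbrev Index : Type u := X.graph.edgeSet → ℕ

variable {X}

open Classical in
/-- `k_v = k({v, p_v})` for `v ≠ root`, and `k_root = 1`. -/
def Index.at (k : X.Index) (v : X.V) : ℕ :=
  if h : X.graph.Adj v (X.parent v) then k ⟨s(v, X.parent v), h⟩ else 1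

open Classical in
/-- The sum of `k(e)` over the edges `e` of a walk. -/
def Index.sumAlong (k : X.Index) {v w : X.V} (p : X.graph.Walk v w) : ℕ :=
  (p.edges.map fun e => if h : e ∈ X.graph.edgeSet then k ⟨e, h⟩ else 0).sum

/-- The sum of `k` over the path between two distinct vertices of non-zero color is positive. -/
def Index.EssentiallyPositive (k : X.Index) : Prop :=
  ∀ v w : X.V, v ≠ w → X.color v ≠ 0 → X.color w ≠ 0 →
    ∀ p : X.graph.Walk v w, p.IsPath → 0 < k.sumAlong p

variable (X) in
/-- `γ`-admissibility. -/
def Admissible (γ : ℝ → ℂ) : Prop :=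
  (∀ v, X.color v = LaurentPoly.const r (γ 0) → 1 < X.deg v) ∧
    X.color X.root ≠ LaurentPoly.const r (γ 0) ∧ X.color X.root ≠ LaurentPoly.const r (γ 1)

/-- `γ`-harvestability of the pair `(X; k)`. -/
structure Harvestable (γ : ℝ → ℂ) (k : X.Index) : Prop where
  admissible : X.Admissible γ
  deg_root : X.deg X.root = 1
  deg_of_ne_zero : ∀ v, X.color v ≠ 0 → X.deg v ≤ 2
  deg_of_eq_zero : ∀ v, X.color v = 0 → X.deg v ≠ 2
  index : ∀ v, k.at v = 0 → X.color v = 0 ∧ X.color (X.parent v) ≠ 0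

/-- The domain `Δ(X; k)`. -/
def domain (k : X.Index) : Set (X.V → ℝ) :=
  {t | (∀ v, t v ∈ Set.Icc (0 : ℝ) 1) ∧
    ∀ v, v ≠ X.root →
      (0 < k.at v → t v < t (X.parent v)) ∧ (k.at v = 0 → t v = t (X.parent v))}

theorem exists_pos_ancestor (k : X.Index) (v : X.V) : ∃ n, 0 < k.at (X.parent^[n] v) := by
  induction hd : X.graph.dist v X.root using Nat.strong_induction_on generalizing v with
  | _ d ih =>
    by_cases hv : 0 < k.at v
    · exact ⟨0, hv⟩
    · have hadj : X.graph.Adj v (X.parent v) := by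
        by_contra hn
        exact hv (by simp [Index.at, hn])
      have hlt : X.graph.dist (X.parent v) X.root < X.graph.dist v X.root := by
        by_cases h : ∃ w, X.graph.Adj v w ∧ X.graph.dist w X.root < X.graph.dist v X.root
        · have : X.parent v = h.choose := dif_pos h
          rw [this]
          exact h.choose_spec.2
        · have : X.parent v = v := dif_neg h
          rw [this] at hadj
          exact absurd hadj (X.graph.irrefl)
      obtain ⟨n, hn⟩ := ih _ (hd ▸ hlt) (X.parent v) rfl
      exact ⟨n + 1, by simpa [Function.iterate_succ_apply] using hn⟩

/-- The vertices `v` with `k_v > 0`; they index the variables of integration. -/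
abbrev FreeVertex (k : X.Index) : Type u := {v : X.V // 0 < k.at v}

/-- The nearest vertex `w` among `v, p_v, p_{p_v}, …` with `k_w > 0`. On `Δ(X; k)` the coordinate
`t_v` equals `t_w`. -/
def carrier (k : X.Index) (v : X.V) : FreeVertex k :=
  ⟨X.parent^[Nat.find (exists_pos_ancestor k v)] v, Nat.find_spec (exists_pos_ancestor k v)⟩

/-- The point of `ℝ^V` with given values of the variables of integration. -/
def point (k : X.Index) (s : FreeVertex k → ℝ) : X.V → ℝ := fun v => s (carrier k v)

section Integral

variable {Γ : Type} [AddCommGroup Γ] [LinearOrder Γ] [IsOrderedAddMonoid Γ]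

/-- The factor `F_{v, k_v}(γ(t))`, without the differential `dt_v`. -/
def factor (mon : (Fin r → ℤ) ≃+ Γ) (γ : ℝ → ℂ) (k : X.Index) (t : X.V → ℝ) (v : X.V) :
    HahnSeries Γ ℂ :=
  if 0 < k.at v then
    (((k.at v - 1).factorial : ℂ)⁻¹ * logDiff γ (t v) (t (X.parent v)) ^ (k.at v - 1)
      * deriv γ (t v)) • fraction mon (γ (t v)) (X.color v)
  else γ (t v) • fraction mon (γ (t v)) (X.color v)

/-- The coefficient at `x^m` of the integrand of `I_γ(X; k)`, in the variables of integration. -/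
def integrand (mon : (Fin r → ℤ) ≃+ Γ) (γ : ℝ → ℂ) (k : X.Index) (m : Fin r → ℤ)
    (s : FreeVertex k → ℝ) : ℂ :=
  (∏ v, factor mon γ k (point k s) v).coeff (mon m)

/-- `Δ(X; k)` in the variables of integration. -/
def freeDomain (k : X.Index) : Set (FreeVertex k → ℝ) := {s | point k s ∈ domain k}

/-- The iterated integral of `(X; k)` converges absolutely, coefficient by coefficient. -/
def Converges (mon : (Fin r → ℤ) ≃+ Γ) (γ : ℝ → ℂ) (k : X.Index) : Prop :=
  ∀ m, IntegrableOn (integrand mon γ k m) (freeDomain k)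

/-- The iterated integral `I_γ(X; k)`, an element of `ℂ⟦x, x⁻¹⟧` given by its coefficients. -/
def iteratedIntegral (mon : (Fin r → ℤ) ≃+ Γ) (γ : ℝ → ℂ) (k : X.Index) :
    (Fin r → ℤ) → ℂ :=
  fun m => ∫ s in freeDomain k, integrand mon γ k m s

end Integral

end ColoredTree

end TreeIntegral

end

noncomputable section

namespace TreeIntegral

namespace ColoredTree

variable {r : ℕ} {D : Set (LaurentPoly r)} (X : ColoredTree.{u} D)

theorem parent_root : X.parent X.root = X.root := by
  unfold parent
  rw [dif_neg]
  simp

theorem exists_adj_dist_lt {v : X.V} (hv : v ≠ X.root) :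
    ∃ w, X.graph.Adj v w ∧ X.graph.dist w X.root < X.graph.dist v X.root := by
  obtain ⟨p, hp⟩ := X.isTree.connected.exists_walk_length_eq_dist v X.root
  cases p with
  | nil => exact absurd rfl hv
  | cons h q =>
    refine ⟨_, h, ?_⟩
    have := X.graph.dist_le q
    simp only [SimpleGraph.Walk.length_cons] at hp
    omega

theorem parent_spec {v : X.V} (hv : v ≠ X.root) :
    X.graph.Adj v (X.parent v) ∧ X.graph.dist (X.parent v) X.root < X.graph.dist v X.root := by
  have h := X.exists_adj_dist_lt hv
  have : X.parent v = h.choose := dif_pos h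
  rw [this]
  exact h.choose_spec

theorem adj_parent {v : X.V} (hv : v ≠ X.root) : X.graph.Adj v (X.parent v) :=
  (X.parent_spec hv).1

theorem dist_parent_lt {v : X.V} (hv : v ≠ X.root) :
    X.graph.dist (X.parent v) X.root < X.graph.dist v X.root :=
  (X.parent_spec hv).2

theorem eq_parent_or_eq_parent {v w : X.V} (h : X.graph.Adj v w) :
    (v ≠ X.root ∧ w = X.parent v) ∨ (w ≠ X.root ∧ v = X.parent w) := by
  classical
  let f : {v : X.V // v ≠ X.root} → X.graph.edgeSet := fun v =>
    ⟨s(v.1, X.parent v.1), X.adj_parent v.2⟩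
  have hinj : Function.Injective f := by
    rintro ⟨a, ha⟩ ⟨b, hb⟩ hab
    have hab' : s(a, X.parent a) = s(b, X.parent b) := congrArg Subtype.val hab
    rcases Sym2.eq_iff.1 hab' with ⟨h1, -⟩ | ⟨h1, h2⟩
    · exact Subtype.ext h1
    · have := X.dist_parent_lt ha
      have := X.dist_parent_lt hb
      rw [h2] at *
      rw [← h1] at *
      omega
  have hcard : Fintype.card {v : X.V // v ≠ X.root} = Fintype.card X.graph.edgeSet := by
    have h1 := X.isTree.card_edgeFinset
    rw [SimpleGraph.edgeFinset_card] at h1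
    have h2 : Fintype.card {v : X.V // v ≠ X.root} = Fintype.card X.V - 1 := by
      rw [Fintype.card_subtype_compl]; simp
    omega
  have hbij := (Fintype.bijective_iff_injective_and_card f).2 ⟨hinj, hcard⟩
  obtain ⟨⟨a, ha⟩, hfa⟩ := hbij.2 ⟨s(v, w), h⟩
  have hfa' : s(a, X.parent a) = s(v, w) := congrArg Subtype.val hfa
  rcases Sym2.eq_iff.1 hfa' with ⟨rfl, rfl⟩ | ⟨rfl, rfl⟩
  · exact Or.inl ⟨ha, rfl⟩
  · exact Or.inr ⟨ha, rfl⟩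

/-- The vertices whose parent is `v`. -/
def children (v : X.V) : Set X.V := {w | w ≠ X.root ∧ X.parent w = v}

theorem deg_root : X.deg X.root = (X.children X.root).ncard := by
  unfold deg
  congr 1
  ext w
  simp only [SimpleGraph.mem_neighborSet, children, Set.mem_ofPred_eq]
  constructor
  · intro h
    rcases X.eq_parent_or_eq_parent h with h | h
    · exact absurd rfl h.1
    · exact ⟨h.1, h.2.symm⟩
  · rintro ⟨h1, h2⟩
    have := X.adj_parent h1
    rw [h2] at this
    exact this.symm

theorem deg_of_ne_root {v : X.V} (hv : v ≠ X.root) :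
    X.deg v = (X.children v).ncard + 1 := by
  unfold deg
  have hnot : X.parent v ∉ X.children v := by
    rintro ⟨h1, h2⟩
    have a1 := X.dist_parent_lt hv
    have a2 := X.dist_parent_lt h1
    rw [h2] at a2
    omega
  rw [← Set.ncard_insert_of_notMem hnot (Set.toFinite _)]
  congr 1
  ext w
  simp only [SimpleGraph.mem_neighborSet, children, Set.mem_ofPred_eq, Set.mem_insert_iff]
  constructor
  · intro h
    rcases X.eq_parent_or_eq_parent h with h | h
    · exact Or.inl h.2
    · exact Or.inr ⟨h.1, h.2.symm⟩
  · rintro (rfl | ⟨h1, h2⟩)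
    · exact X.adj_parent hv
    · have := X.adj_parent h1
      rw [h2] at this
      exact this.symm

variable {X}

theorem Index.at_root (k : X.Index) : k.at X.root = 1 := by
  unfold Index.at
  rw [dif_neg]
  rw [parent_root]
  exact X.graph.irrefl

theorem Index.at_of_ne_root (k : X.Index) {v : X.V} (hv : v ≠ X.root) :
    k.at v = k ⟨s(v, X.parent v), X.adj_parent hv⟩ :=
  dif_pos _

theorem ne_root_of_at_eq_zero (k : X.Index) {v : X.V} (hv : k.at v = 0) : v ≠ X.root := by
  rintro rfl
  simp [Index.at_root] at hv

theorem carrier_of_pos (k : X.Index) {v : X.V} (hv : 0 < k.at v) : carrier k v = ⟨v, hv⟩ := by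
  have h0 : Nat.find (exists_pos_ancestor k v) = 0 := by
    rw [Nat.find_eq_zero]
    exact hv
  apply Subtype.ext
  simp [carrier, h0]

theorem carrier_parent (k : X.Index) {v : X.V} (hv : k.at v = 0) :
    carrier k (X.parent v) = carrier k v := by
  have h0 : Nat.find (exists_pos_ancestor k v) =
      Nat.find (exists_pos_ancestor k (X.parent v)) + 1 := by
    rw [Nat.find_comp_succ (exists_pos_ancestor k v)
      (by simpa only [Function.iterate_succ_apply] using exists_pos_ancestor k (X.parent v))
      (by simp [hv])]
    congr 1
  apply Subtype.ext
  simp only [carrier, h0, Function.iterate_succ_apply]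

theorem carrier_root (k : X.Index) :
    carrier k X.root = ⟨X.root, by simp [Index.at_root]⟩ := carrier_of_pos k _

theorem dist_carrier_le (k : X.Index) (v : X.V) :
    X.graph.dist (carrier k v).1 X.root ≤ X.graph.dist v X.root := by
  induction hd : X.graph.dist v X.root using Nat.strong_induction_on generalizing v with
  | _ d ih =>
    by_cases hv : 0 < k.at v
    · rw [carrier_of_pos k hv, hd]
    · have hv0 : k.at v = 0 := by omega
      have hlt := X.dist_parent_lt (ne_root_of_at_eq_zero k hv0)
      have := ih _ (hd ▸ hlt) (X.parent v) rfl
      rw [carrier_parent k hv0] at this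
      omega

/-- A vertex is joined to its carrier by edges of index zero. -/
theorem exists_walk_carrier (k : X.Index) (v : X.V) :
    ∃ p : X.graph.Walk v (carrier k v).1,
      ∀ e ∈ p.edges, ∀ h : e ∈ X.graph.edgeSet, k ⟨e, h⟩ = 0 := by
  induction hd : X.graph.dist v X.root using Nat.strong_induction_on generalizing v with
  | _ d ih =>
    by_cases hv : 0 < k.at v
    · rw [carrier_of_pos k hv]
      exact ⟨SimpleGraph.Walk.nil, by simp⟩
    · have hv0 : k.at v = 0 := by omega
      have hr := ne_root_of_at_eq_zero k hv0
      obtain ⟨p, hp⟩ := ih _ (hd ▸ X.dist_parent_lt hr) (X.parent v) rfl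
      rw [← carrier_parent k hv0]
      refine ⟨SimpleGraph.Walk.cons (X.adj_parent hr) p, ?_⟩
      intro e he h
      rw [SimpleGraph.Walk.edges_cons, List.mem_cons] at he
      rcases he with rfl | he
      · rw [← hv0, k.at_of_ne_root hr]
      · exact hp e he h

/-- For an essentially positive index, vertices joined by edges of index zero do not both have
non-zero color. -/
theorem Index.EssentiallyPositive.eq_of_carrier_eq {k : X.Index} (hk : k.EssentiallyPositive)
    {v w : X.V} (hv : X.color v ≠ 0) (hw : X.color w ≠ 0) (h : carrier k v = carrier k w) :
    v = w := by
  classical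
  by_contra hne
  obtain ⟨p, hp⟩ := exists_walk_carrier k v
  obtain ⟨q, hq⟩ : ∃ q : X.graph.Walk w (carrier k v).1,
      ∀ e ∈ q.edges, ∀ h : e ∈ X.graph.edgeSet, k ⟨e, h⟩ = 0 := h ▸ exists_walk_carrier k w
  have hpos := hk v w hne hv hw (p.append q.reverse).bypass (SimpleGraph.Walk.bypass_isPath _)
  refine hpos.ne' ?_
  unfold Index.sumAlong
  rw [List.sum_eq_zero]
  intro x hx
  rw [List.mem_map] at hx
  obtain ⟨e, he, rfl⟩ := hx
  split_ifs with h'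
  · have := SimpleGraph.Walk.edges_bypass_subset_edges _ he
    rw [SimpleGraph.Walk.edges_append, List.mem_append, SimpleGraph.Walk.edges_reverse,
      List.mem_reverse] at this
    rcases this with h1 | h1
    · exact hp e h1 h'
    · exact hq e h1 h'
  · rfl

end ColoredTree

section OfParent

variable {V : Type u} (root : V) (par : V → V)

/-- The graph in which every vertex other than the root is joined to its parent. -/
def parentGraph : SimpleGraph V :=
  SimpleGraph.fromRel fun v w => v ≠ root ∧ w = par v

variable {root par}

theorem parentGraph_adj_par (h : V → ℕ) (hh : ∀ v, v ≠ root → h (par v) < h v)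
    {v : V} (hv : v ≠ root) :
    (parentGraph root par).Adj v (par v) := by
  rw [parentGraph, SimpleGraph.fromRel_adj]
  refine ⟨fun e => ?_, Or.inl ⟨hv, rfl⟩⟩
  have := hh v hv
  rw [← e] at this
  exact lt_irrefl _ this

theorem parentGraph_isTree [Fintype V] (h : V → ℕ) (hh : ∀ v, v ≠ root → h (par v) < h v) :
    (parentGraph root par).IsTree := by
  classical
  have hreach : ∀ v, (parentGraph root par).Reachable v root := by
    intro v
    induction hd : h v using Nat.strong_induction_on generalizing v with
    | _ d ih =>
      by_cases hv : v = root
      · rw [hv]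
      · exact (parentGraph_adj_par h hh hv).reachable.trans (ih _ (hd ▸ hh v hv) _ rfl)
  have hconn : (parentGraph root par).Connected :=
    { preconnected := fun v w => (hreach v).trans (hreach w).symm
      nonempty := ⟨root⟩ }
  rw [SimpleGraph.isTree_iff_connected_and_card]
  refine ⟨hconn, le_antisymm ?_ hconn.card_vert_le_card_edgeSet_add_one⟩
  let f : {v : V // v ≠ root} → (parentGraph root par).edgeSet := fun v =>
    ⟨s(v.1, par v.1), parentGraph_adj_par h hh v.2⟩
  have hf : Function.Surjective f := by
    rintro ⟨e, he⟩
    induction e using Sym2.ind with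
    | _ a b =>
      rw [SimpleGraph.mem_edgeSet, parentGraph, SimpleGraph.fromRel_adj] at he
      rcases he.2 with ⟨h1, rfl⟩ | ⟨h1, rfl⟩
      · exact ⟨⟨a, h1⟩, rfl⟩
      · exact ⟨⟨b, h1⟩, Subtype.ext Sym2.eq_swap⟩
  have h1 := Nat.card_le_card_of_surjective f hf
  have h2 : Fintype.card {v : V // v ≠ root} = Fintype.card V - 1 := by
    rw [Fintype.card_subtype_compl]; simp
  have h3 : 0 < Fintype.card V := Fintype.card_pos_iff.2 ⟨root⟩
  rw [Nat.card_eq_fintype_card (α := {v : V // v ≠ root}), h2] at h1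
  rw [Nat.card_eq_fintype_card (α := V)]
  omega

variable {r : ℕ} {D : Set (LaurentPoly r)} (h : V → ℕ) (hh : ∀ v, v ≠ root → h (par v) < h v)

/-- The colored tree given by a parent function. -/
abbrev ColoredTree.ofParent [Fintype V] (color : V → LaurentPoly r) (hc : ∀ v, color v ∈ D) :
    ColoredTree.{u} D where
  V := V
  graph := parentGraph root par
  isTree := parentGraph_isTree h hh
  root := root
  color := color
  color_mem := hc

variable [Fintype V] (color : V → LaurentPoly r) (hc : ∀ v, color v ∈ D)

theorem ColoredTree.parent_ofParent {v : V} (hv : v ≠ root) :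
    (ColoredTree.ofParent h hh color hc).parent v = par v := by
  induction hd : h v using Nat.strong_induction_on generalizing v with
  | _ d ih =>
    have hadj : (ColoredTree.ofParent h hh color hc).graph.Adj v (par v) :=
      parentGraph_adj_par h hh hv
    rcases (ColoredTree.ofParent h hh color hc).eq_parent_or_eq_parent hadj with ⟨-, h1⟩ | ⟨h1, h2⟩
    · exact h1.symm
    · exfalso
      have a1 := hh v hv
      have a2 := hh (par v) h1
      have a3 := ih _ (hd ▸ a1) h1 rfl
      rw [a3] at h2
      rw [← h2] at a2
      omega

open Classical in
/-- The index with prescribed values at the vertices other than the root. -/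
def ColoredTree.indexOfParent (idx : V → ℕ) : (ColoredTree.ofParent h hh color hc).Index :=
  fun e => if he : ∃ v, v ≠ root ∧ e.1 = s(v, par v) then idx he.choose else 0

theorem ColoredTree.at_indexOfParent (idx : V → ℕ) {v : V} (hv : v ≠ root) :
    (ColoredTree.indexOfParent h hh color hc idx).at v = idx v := by
  rw [Index.at_of_ne_root _ hv]
  have he : ∃ w, w ≠ root ∧ s(v, (ColoredTree.ofParent h hh color hc).parent v) = s(w, par w) :=
    ⟨v, hv, by rw [ColoredTree.parent_ofParent h hh color hc hv]⟩
  unfold indexOfParent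
  rw [dif_pos he]
  congr 1
  obtain ⟨h1, h2⟩ := he.choose_spec
  generalize he.choose = w at *
  rw [ColoredTree.parent_ofParent h hh color hc hv] at h2
  rcases Sym2.eq_iff.1 h2 with ⟨h3, -⟩ | ⟨h3, h4⟩
  · exact h3.symm
  · have a1 := hh v hv
    have a2 := hh _ h1
    rw [← h3, ← h4] at a2
    omega

end OfParent

theorem hahnSeries_prod_smul {ι Γ : Type*} [AddCommMonoid Γ] [PartialOrder Γ]
    [IsOrderedCancelAddMonoid Γ] (t : Finset ι) (c : ι → ℂ) (f : ι → HahnSeries Γ ℂ) :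
    ∏ i ∈ t, c i • f i = (∏ i ∈ t, c i) • ∏ i ∈ t, f i := by
  simp only [← HahnSeries.C_mul_eq_smul, Finset.prod_mul_distrib, map_prod]

/-- A rooted tree with colored vertices and positive indices, given by its parent function. -/
structure PosTree (r : ℕ) (V : Type u) where
  root : V
  par : V → V
  color : V → LaurentPoly r
  idx : V → ℕ
  par_root : par root = root
  idx_root : idx root = 1
  idx_pos : ∀ v, 0 < idx v
  exists_rank : ∃ h : V → ℕ, ∀ v, v ≠ root → h (par v) < h v

namespace PosTree

variable {r : ℕ} {V : Type u} (N : PosTree r V)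

/-- The vertices whose parent is `v`. -/
def children (v : V) : Set V := {w | w ≠ N.root ∧ N.par w = v}

/-- The domain of integration, without the faces of the cube. -/
def domain : Set (V → ℝ) :=
  {s | (∀ v, s v ∈ Set.Ioo (0 : ℝ) 1) ∧ ∀ v, v ≠ N.root → s v < s (N.par v)}

/-- The scalar part of the factor of a vertex. -/
def scalar (γ : ℝ → ℂ) (s : V → ℝ) (v : V) : ℂ :=
  ((N.idx v - 1).factorial : ℂ)⁻¹ * logDiff γ (s v) (s (N.par v)) ^ (N.idx v - 1)
    * deriv γ (s v)

variable {Γ : Type} [AddCommGroup Γ] [LinearOrder Γ] [IsOrderedAddMonoid Γ] [Fintype V]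

/-- The coefficient at `x^m` of the integrand. -/
def integrand (mon : (Fin r → ℤ) ≃+ Γ) (γ : ℝ → ℂ) (m : Fin r → ℤ) (s : V → ℝ) : ℂ :=
  (∏ v, N.scalar γ s v • fraction mon (γ (s v)) (N.color v)).coeff (mon m)

/-- Absolute convergence, coefficient by coefficient. -/
def Converges (mon : (Fin r → ℤ) ≃+ Γ) (γ : ℝ → ℂ) : Prop :=
  ∀ m, IntegrableOn (N.integrand mon γ m) N.domain

/-- The integral, given by its coefficients. -/
def integral (mon : (Fin r → ℤ) ≃+ Γ) (γ : ℝ → ℂ) : (Fin r → ℤ) → ℂ :=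
  fun m => ∫ s in N.domain, N.integrand mon γ m s

omit [Fintype V] in
theorem measurableSet_domain [Finite V] : MeasurableSet N.domain := by
  have : N.domain = (⋂ v, {s | s v ∈ Set.Ioo (0 : ℝ) 1}) ∩
      ⋂ v, {s | v ≠ N.root → s v < s (N.par v)} := by
    ext s
    simp [domain]
  rw [this]
  have : Countable V := Finite.to_countable
  refine (MeasurableSet.iInter fun v => measurable_pi_apply v measurableSet_Ioo).inter
    (MeasurableSet.iInter fun v => ?_)
  by_cases hv : v = N.root
  · simp [hv]
  · simpa [hv] using measurableSet_lt (measurable_pi_apply v) (measurable_pi_apply (N.par v))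

theorem integrand_eq_mul (mon : (Fin r → ℤ) ≃+ Γ) (γ : ℝ → ℂ) (m : Fin r → ℤ) (s : V → ℝ) :
    N.integrand mon γ m s =
      (∏ v, N.scalar γ s v) * (∏ v, fraction mon (γ (s v)) (N.color v)).coeff (mon m) := by
  unfold integrand
  rw [hahnSeries_prod_smul, HahnSeries.coeff_smul, smul_eq_mul]

end PosTree

section Fraction

variable {r : ℕ} {Γ : Type} [AddCommGroup Γ] [LinearOrder Γ] [IsOrderedAddMonoid Γ]

theorem fraction_const (mon : (Fin r → ℤ) ≃+ Γ) (z c : ℂ) :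
    fraction mon z (LaurentPoly.const r c) = HahnSeries.C (z - c)⁻¹ := by
  have : expand mon (LaurentPoly.const r c) = HahnSeries.C c := by
    unfold expand LaurentPoly.const
    rw [AddMonoidAlgebra.coe_algebraMap]
    simp
  rw [fraction, this, ← map_sub, map_inv₀]

theorem fraction_zero (mon : (Fin r → ℤ) ≃+ Γ) (z : ℂ) :
    fraction mon z 0 = HahnSeries.C z⁻¹ := by
  have := fraction_const mon z 0
  rwa [LaurentPoly.const, map_zero, sub_zero] at this

theorem smul_fraction_zero (mon : (Fin r → ℤ) ≃+ Γ) {z : ℂ} (hz : z ≠ 0) :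
    z • fraction mon z 0 = 1 := by
  rw [fraction_zero, ← HahnSeries.C_mul_eq_smul, ← map_mul, mul_inv_cancel₀ hz, map_one]

end Fraction

namespace ColoredTree

variable {r : ℕ} {D : Set (LaurentPoly r)} {X : ColoredTree.{u} D} {V : Type u}

/-- `N` arises from `(X; k)` by contracting the edges of index zero. Every vertex of `N` gets the
only non-zero color of the corresponding vertices of `X`, if there is one. -/
structure IsContraction (k : X.Index) (N : PosTree r V) (e : FreeVertex k ≃ V) : Prop where
  root : e (carrier k X.root) = N.root
  par : ∀ v : FreeVertex k, N.par (e v) = e (carrier k (X.parent v))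
  idx : ∀ v : FreeVertex k, N.idx (e v) = k.at v
  color_eq : ∀ x, X.color x ≠ 0 → N.color (e (carrier k x)) = X.color x
  unique : ∀ x y, X.color x ≠ 0 → X.color y ≠ 0 → carrier k x = carrier k y → x = y
  exists_color : ∀ v, N.color (e v) ≠ 0 → ∃ x, carrier k x = v ∧ X.color x ≠ 0

variable {Γ : Type} [AddCommGroup Γ] [LinearOrder Γ] [IsOrderedAddMonoid Γ]
  {k : X.Index} {N : PosTree r V} {e : FreeVertex k ≃ V}

theorem mem_freeDomain (k : X.Index) (s : FreeVertex k → ℝ) :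
    s ∈ freeDomain k ↔ (∀ v, s v ∈ Set.Icc (0 : ℝ) 1) ∧
      ∀ v : FreeVertex k, v.1 ≠ X.root → s v < s (carrier k (X.parent v)) := by
  simp only [freeDomain, domain, point, Set.mem_ofPred_eq]
  constructor
  · rintro ⟨h1, h2⟩
    refine ⟨fun v => ?_, fun v hv => ?_⟩
    · have := h1 v.1
      rwa [carrier_of_pos k v.2] at this
    · have := (h2 v.1 hv).1 v.2
      rwa [carrier_of_pos k v.2] at this
  · rintro ⟨h1, h2⟩
    refine ⟨fun v => h1 _, fun v hv => ⟨fun hp => ?_, fun h0 => ?_⟩⟩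
    · rw [carrier_of_pos k hp]
      exact h2 ⟨v, hp⟩ hv
    · rw [carrier_parent k h0]

theorem IsContraction.mem_domain_iff (hN : IsContraction k N e) (s : V → ℝ) :
    s ∈ N.domain ↔ (∀ v, s (e v) ∈ Set.Ioo (0 : ℝ) 1) ∧
      ∀ v : FreeVertex k, v.1 ≠ X.root → s (e v) < s (e (carrier k (X.parent v))) := by
  have hroot : ∀ v : FreeVertex k, e v = N.root ↔ v.1 = X.root := by
    intro v
    rw [← hN.root, e.apply_eq_iff_eq, carrier_root, Subtype.ext_iff]
  simp only [PosTree.domain, Set.mem_ofPred_eq, e.surjective.forall, hN.par, ne_eq, hroot]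

variable [Fintype V]

theorem IsContraction.prod_factor (hN : IsContraction k N e) (mon : (Fin r → ℤ) ≃+ Γ) (γ : ℝ → ℂ)
    (s : V → ℝ) (hs : ∀ v, γ (s v) ≠ 0) :
    ∏ v, factor mon γ k (point k fun w => s (e w)) v =
      ∏ v, N.scalar γ s v • fraction mon (γ (s v)) (N.color v) := by
  classical
  rw [← Finset.prod_fiberwise (s := Finset.univ) (g := fun x => e (carrier k x))]
  refine Finset.prod_congr rfl fun w _ => ?_
  obtain ⟨v, rfl⟩ := e.surjective w
  have hg : ∀ x, carrier k x = v →
      factor mon γ k (point k fun w => s (e w)) x =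
        (if x = v.1 then N.scalar γ s (e v) * (γ (s (e v)))⁻¹ else 1) •
          (γ (s (e v)) • fraction mon (γ (s (e v))) (X.color x)) := by
    rintro x rfl
    by_cases hx : 0 < k.at x
    · rw [if_pos (by rw [carrier_of_pos k hx])]
      rw [smul_smul, mul_assoc, inv_mul_cancel₀ (hs _), mul_one]
      unfold factor PosTree.scalar point
      rw [if_pos hx, hN.idx, hN.par, carrier_of_pos k hx]
    · rw [if_neg (fun h => hx (by rw [h]; exact (carrier k x).2)), one_smul]
      unfold factor point
      rw [if_neg hx]
  rw [Finset.prod_congr rfl fun x hx => hg x (e.injective (Finset.mem_filter.1 hx).2),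
    hahnSeries_prod_smul]
  have h1 : ∏ x with e (carrier k x) = e v,
      (if x = v.1 then N.scalar γ s (e v) * (γ (s (e v)))⁻¹ else 1) =
        N.scalar γ s (e v) * (γ (s (e v)))⁻¹ := by
    rw [Finset.prod_ite_eq', if_pos]
    rw [Finset.mem_filter]
    exact ⟨Finset.mem_univ _, by rw [carrier_of_pos k v.2]⟩
  have h2 : ∏ x with e (carrier k x) = e v,
      γ (s (e v)) • fraction mon (γ (s (e v))) (X.color x) =
        γ (s (e v)) • fraction mon (γ (s (e v))) (N.color (e v)) := by
    by_cases hc : N.color (e v) = 0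
    · rw [hc, smul_fraction_zero mon (hs _)]
      refine Finset.prod_eq_one fun x hx => ?_
      have hx' := e.injective (Finset.mem_filter.1 hx).2
      have : X.color x = 0 := by
        by_contra h
        have := hN.color_eq x h
        rw [hx', hc] at this
        exact h this.symm
      rw [this, smul_fraction_zero mon (hs _)]
    · obtain ⟨x, rfl, hx⟩ := hN.exists_color v hc
      rw [hN.color_eq x hx]
      refine Finset.prod_eq_single_of_mem x (by simp) fun y hy hyx => ?_
      have hy' := e.injective (Finset.mem_filter.1 hy).2
      have : X.color y = 0 := by
        by_contra h
        exact hyx (hN.unique y x h hx hy')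
      rw [this, smul_fraction_zero mon (hs _)]
  rw [h1, h2, smul_smul, mul_assoc, inv_mul_cancel₀ (hs _), mul_one]

theorem IsContraction.integrable_and_integral_eq (hN : IsContraction k N e)
    (mon : (Fin r → ℤ) ≃+ Γ) (γ : ℝ → ℂ)
    (hγ : ∀ t ∈ Set.Ioo (0 : ℝ) 1, γ t ≠ 0) (m : Fin r → ℤ) :
    (IntegrableOn (integrand mon γ k m) (freeDomain k) ↔
      IntegrableOn (N.integrand mon γ m) N.domain) ∧
    ∫ s in freeDomain k, integrand mon γ k m s = ∫ s in N.domain, N.integrand mon γ m s := by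
  let Φ := MeasurableEquiv.piCongrLeft (fun _ : V => ℝ) e
  have hΦ : MeasurePreserving Φ := volume_measurePreserving_piCongrLeft (fun _ : V => ℝ) e
  have hΦe : ∀ s v, Φ s (e v) = s v := fun s v =>
    Equiv.piCongrLeft_apply_apply (fun _ : V => ℝ) e s v
  have hmeas : MeasurableSet (Φ ⁻¹' N.domain) := Φ.measurable N.measurableSet_domain
  have hset : freeDomain k =ᵐ[volume] Φ ⁻¹' N.domain := by
    have h1 : Φ ⁻¹' N.domain = freeDomain k ∩ Set.univ.pi fun _ => Set.Ioo (0 : ℝ) 1 := by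
      ext s
      simp only [Set.mem_preimage, hN.mem_domain_iff, hΦe, Set.mem_inter_iff, mem_freeDomain,
        Set.mem_pi, Set.mem_univ, true_implies]
      constructor
      · rintro ⟨h1, h2⟩
        exact ⟨⟨fun v => Set.Ioo_subset_Icc_self (h1 v), h2⟩, h1⟩
      · rintro ⟨⟨-, h2⟩, h3⟩
        exact ⟨h3, h2⟩
    have h2 : freeDomain k = freeDomain k ∩ Set.Icc 0 1 := by
      refine (Set.inter_eq_left.2 fun s hs => ?_).symm
      have := ((mem_freeDomain k s).1 hs).1
      exact ⟨fun v => (this v).1, fun v => (this v).2⟩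
    rw [h1]
    conv_lhs => rw [h2]
    exact (ae_eq_refl _).inter (Measure.univ_pi_Ioo_ae_eq_Icc
      (μ := fun _ : FreeVertex k => (volume : Measure ℝ)) (f := 0) (g := 1)).symm
  have hint : ∀ s ∈ Φ ⁻¹' N.domain, integrand mon γ k m s = N.integrand mon γ m (Φ s) := by
    intro s hs
    have hs' : (fun w => Φ s (e w)) = s := funext (hΦe s)
    unfold integrand PosTree.integrand
    rw [← hN.prod_factor mon γ (Φ s) (fun v => hγ _ (hs.1 v)), hs']
  constructor
  · have h1 : IntegrableOn (integrand mon γ k m) (freeDomain k) ↔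
        IntegrableOn (integrand mon γ k m) (Φ ⁻¹' N.domain) := integrableOn_congr_set_ae hset
    have h2 : IntegrableOn (integrand mon γ k m) (Φ ⁻¹' N.domain) ↔
        IntegrableOn (N.integrand mon γ m ∘ Φ) (Φ ⁻¹' N.domain) :=
      integrableOn_congr_fun hint hmeas
    rw [h1, h2]
    exact hΦ.integrableOn_comp_preimage Φ.measurableEmbedding
  · rw [setIntegral_congr_set hset, setIntegral_congr_fun hmeas hint]
    exact hΦ.setIntegral_preimage_emb Φ.measurableEmbedding _ _

theorem IsContraction.converges_iff (hN : IsContraction k N e)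
    (mon : (Fin r → ℤ) ≃+ Γ) (γ : ℝ → ℂ) (hγ : ∀ t ∈ Set.Ioo (0 : ℝ) 1, γ t ≠ 0) :
    Converges mon γ k ↔ N.Converges mon γ :=
  forall_congr' fun m => (hN.integrable_and_integral_eq mon γ hγ m).1

theorem IsContraction.iteratedIntegral_eq (hN : IsContraction k N e)
    (mon : (Fin r → ℤ) ≃+ Γ) (γ : ℝ → ℂ) (hγ : ∀ t ∈ Set.Ioo (0 : ℝ) 1, γ t ≠ 0) :
    iteratedIntegral mon γ k = N.integral mon γ :=
  funext fun m => (hN.integrable_and_integral_eq mon γ hγ m).2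

end ColoredTree

section HahnMap

variable {Γ : Type*} [AddCommGroup Γ] [LinearOrder Γ] [IsOrderedAddMonoid Γ]

/-- The ring homomorphism of Hahn series that applies a ring homomorphism to each coefficient. -/
def hahnMap {R S : Type*} [CommRing R] [CommRing S] (f : R →+* S) :
    HahnSeries Γ R →+* HahnSeries Γ S where
  toFun x := x.map f
  map_one' := by
    ext g
    simp only [HahnSeries.map_coeff, HahnSeries.coeff_one]
    split_ifs <;> simp
  map_mul' x y := HahnSeries.map_mul (f : R →ₙ+* S)
  map_zero' := by ext; simp
  map_add' x y := by ext; simp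

@[simp]
theorem coeff_hahnMap {R S : Type*} [CommRing R] [CommRing S] (f : R →+* S)
    (x : HahnSeries Γ R) (g : Γ) : (hahnMap f x).coeff g = f (x.coeff g) := rfl

@[simp]
theorem hahnMap_single {R S : Type*} [CommRing R] [CommRing S] (f : R →+* S) (g : Γ) (a : R) :
    hahnMap f (HahnSeries.single g a) = HahnSeries.single g (f a) := by
  ext g'
  by_cases h : g' = g
  · subst h; simp
  · simp [HahnSeries.coeff_single_of_ne h]

@[simp]
theorem hahnMap_C {R S : Type*} [CommRing R] [CommRing S] (f : R →+* S) (a : R) :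
    hahnMap f (HahnSeries.C a : HahnSeries Γ R) = HahnSeries.C (f a) :=
  hahnMap_single f 0 a

end HahnMap

section Fraction

variable {r : ℕ} {Γ : Type} [AddCommGroup Γ] [LinearOrder Γ] [IsOrderedAddMonoid Γ]

theorem const_injective (r : ℕ) : Function.Injective (LaurentPoly.const r) :=
  FaithfulSMul.algebraMap_injective ℂ (LaurentPoly r)

open Classical in
/-- The factor `1 / (z - a)` for constant `a`, and `1` otherwise. -/
def pole (a : LaurentPoly r) (z : ℂ) : ℂ :=
  if h : ∃ c, a = LaurentPoly.const r c then (z - h.choose)⁻¹ else 1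

theorem pole_const (c z : ℂ) : pole (LaurentPoly.const r c) z = (z - c)⁻¹ := by
  have h : ∃ c', LaurentPoly.const r c = LaurentPoly.const r c' := ⟨c, rfl⟩
  unfold pole
  rw [dif_pos h, ← const_injective r h.choose_spec]

theorem pole_of_not_const {a : LaurentPoly r} (h : ¬ ∃ c, a = LaurentPoly.const r c) (z : ℂ) :
    pole a z = 1 := dif_neg h

/-- A Laurent polynomial as a series with constant functions as coefficients. -/
def expandConst {T : Type*} [TopologicalSpace T] (mon : (Fin r → ℤ) ≃+ Γ) (a : LaurentPoly r) :
    HahnSeries Γ C(T, ℂ) :=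
  a.coeff.sum fun m c => HahnSeries.single (mon m) (ContinuousMap.const T c)

omit [IsOrderedAddMonoid Γ] in
theorem coeff_expandConst {T : Type*} [TopologicalSpace T] (mon : (Fin r → ℤ) ≃+ Γ)
    (a : LaurentPoly r) (m : Fin r → ℤ) :
    (expandConst (T := T) mon a).coeff (mon m) = ContinuousMap.const T (a.coeff m) := by
  classical
  unfold expandConst Finsupp.sum
  rw [HahnSeries.coeff_sum]
  simp only [HahnSeries.coeff_single, EmbeddingLike.apply_eq_iff_eq]
  rw [Finset.sum_ite_eq]
  split_ifs with h
  · rfl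
  · rw [Finsupp.notMem_support_iff.1 h]
    rfl

theorem hahnMap_expandConst {T : Type*} [TopologicalSpace T] (mon : (Fin r → ℤ) ≃+ Γ)
    (a : LaurentPoly r) (f : C(T, ℂ) →+* ℂ) (hf : ∀ c, f (ContinuousMap.const T c) = c) :
    hahnMap f (expandConst mon a) = expand mon a := by
  unfold expandConst expand Finsupp.sum
  simp [hf]

/-- If `a` is regular along `γ`, the coefficients of `1 / (γ(t) - a)` are continuous on
`[0,1]`. -/
theorem exists_series_fraction (mon : (Fin r → ℤ) ≃+ Γ) {γ : ℝ → ℂ}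
    (hγ : ContinuousOn γ (Set.Icc 0 1)) {a : LaurentPoly r} (ha : RegularAlong mon γ a) :
    ∃ F : HahnSeries Γ C(Set.Icc (0 : ℝ) 1, ℂ), ∀ t : Set.Icc (0 : ℝ) 1,
      hahnMap (ContinuousMap.evalAlgHom ℂ ℂ t : C(Set.Icc (0 : ℝ) 1, ℂ) →+* ℂ) F =
        fraction mon (γ t) a := by
  let z : C(Set.Icc (0 : ℝ) 1, ℂ) := ⟨fun t => γ t, hγ.domRestrict⟩
  let G : HahnSeries Γ C(Set.Icc (0 : ℝ) 1, ℂ) := HahnSeries.C z - expandConst mon a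
  have hcoeff : ∀ m, G.coeff (mon m) =
      (if m = 0 then z else 0) - ContinuousMap.const _ (a.coeff m) := by
    intro m
    simp only [G, HahnSeries.coeff_sub, coeff_expandConst]
    congr 1
    split_ifs with h
    · rw [h, map_zero, HahnSeries.C_apply, HahnSeries.coeff_single_same]
    · rw [HahnSeries.C_apply, HahnSeries.coeff_single_of_ne]
      simpa using h
  have hne : ∀ {m}, mon m < 0 → m ≠ 0 := by
    rintro m hm rfl
    simp at hm
  have hunit : IsUnit G := by
    refine HahnSeries.isUnit_of_isUnit_leadingCoeff_AddUnitOrder ?_ (AddGroup.isAddUnit _)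
    obtain ⟨n, hn⟩ := mon.surjective G.order
    rw [HahnSeries.leadingCoeff_eq, ← hn, hcoeff, ContinuousMap.isUnit_iff_forall_ne_zero]
    by_cases hneg : ∃ m, mon m < 0 ∧ a.coeff m ≠ 0
    · obtain ⟨m, hm, hm0⟩ := hneg
      have h1 : G.coeff (mon m) ≠ 0 := by
        rw [hcoeff, if_neg (hne hm), zero_sub, neg_ne_zero]
        intro h
        exact hm0 (by simpa using DFunLike.congr_fun h ⟨0, by simp⟩)
      have h2 : mon n < 0 := hn ▸ (HahnSeries.order_le_of_coeff_ne_zero h1).trans_lt hm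
      have h3 : G.coeff (mon n) ≠ 0 := by
        rw [hn]
        intro h
        rw [HahnSeries.coeff_order_eq_zero.1 h] at h1
        exact h1 rfl
      rw [hcoeff, if_neg (hne h2)] at h3
      rw [if_neg (hne h2)]
      intro t ht
      apply h3
      ext u
      simpa using ht
    · have hreg : ∀ t ∈ Set.Icc (0 : ℝ) 1, γ t ≠ a.coeff 0 := ha.resolve_left hneg
      push Not at hneg
      have h1 : G.coeff (mon 0) ≠ 0 := by
        rw [hcoeff, if_pos rfl]
        intro h
        have := DFunLike.congr_fun h ⟨0, by simp⟩
        exact hreg 0 (by simp) (sub_eq_zero.1 this)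
      have h2 : mon n ≤ mon 0 := hn ▸ HahnSeries.order_le_of_coeff_ne_zero h1
      have h3 : n = 0 := by
        by_contra h0
        have h4 : mon n < 0 := lt_of_le_of_ne (by simpa using h2) (by simpa using h0)
        have h5 : G.coeff (mon n) = 0 := by
          rw [hcoeff, if_neg h0, hneg n h4]
          ext; simp
        rw [hn] at h5
        rw [HahnSeries.coeff_order_eq_zero.1 h5] at h1
        exact h1 rfl
      subst h3
      intro t ht
      rw [if_pos rfl] at ht
      exact hreg t t.2 (sub_eq_zero.1 ht)
  obtain ⟨F, hF⟩ := hunit.exists_left_inv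
  refine ⟨F, fun t => ?_⟩
  unfold fraction
  refine eq_inv_of_mul_eq_one_left ?_
  have := congrArg (hahnMap (ContinuousMap.evalAlgHom ℂ ℂ t : C(Set.Icc (0 : ℝ) 1, ℂ) →+* ℂ)) hF
  rw [map_mul, map_one] at this
  rw [← this]
  congr 1
  simp only [G, map_sub, hahnMap_C]
  rw [hahnMap_expandConst]
  · rfl
  · intro c; rfl

/-- The coefficients of a product of fractions along `γ` are, up to the poles at the constant
colors, continuous on the closed cube. -/
theorem exists_coeff_prod_fraction {V : Type*} [Fintype V] (mon : (Fin r → ℤ) ≃+ Γ) {γ : ℝ → ℂ}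
    (hγ : ContinuousOn γ (Set.Icc 0 1)) (c : V → LaurentPoly r)
    (hc : ∀ v, (∀ z, c v ≠ LaurentPoly.const r z) → RegularAlong mon γ (c v)) (g : Γ) :
    ∃ q : C(V → Set.Icc (0 : ℝ) 1, ℂ), ∀ s : V → Set.Icc (0 : ℝ) 1,
      (∏ v, fraction mon (γ (s v)) (c v)).coeff g = (∏ v, pole (c v) (γ (s v))) * q s := by
  have hF : ∀ v, ∃ F : HahnSeries Γ C(Set.Icc (0 : ℝ) 1, ℂ), ∀ t : Set.Icc (0 : ℝ) 1,
      fraction mon (γ t) (c v) = pole (c v) (γ t) •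
        hahnMap (ContinuousMap.evalAlgHom ℂ ℂ t : C(Set.Icc (0 : ℝ) 1, ℂ) →+* ℂ) F := by
    intro v
    by_cases h : ∃ z, c v = LaurentPoly.const r z
    · obtain ⟨z, hz⟩ := h
      refine ⟨1, fun t => ?_⟩
      rw [hz, fraction_const, pole_const, map_one, ← HahnSeries.C_mul_eq_smul, mul_one]
    · obtain ⟨F, hF⟩ := exists_series_fraction mon hγ (hc v (not_exists.1 h))
      refine ⟨F, fun t => ?_⟩
      rw [hF, pole_of_not_const h, one_smul]
  choose F hF using hF
  let pr : V → C(V → Set.Icc (0 : ℝ) 1, Set.Icc (0 : ℝ) 1) := fun v =>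
    ⟨fun s => s v, continuous_apply v⟩
  let E : HahnSeries Γ C(V → Set.Icc (0 : ℝ) 1, ℂ) :=
    ∏ v, hahnMap (ContinuousMap.compRightAlgHom ℂ ℂ (pr v) :
      C(Set.Icc (0 : ℝ) 1, ℂ) →+* C(V → Set.Icc (0 : ℝ) 1, ℂ)) (F v)
  refine ⟨E.coeff g, fun s => ?_⟩
  have hE : hahnMap (ContinuousMap.evalAlgHom ℂ ℂ s : C(V → Set.Icc (0 : ℝ) 1, ℂ) →+* ℂ) E =
      ∏ v, hahnMap (ContinuousMap.evalAlgHom ℂ ℂ (s v) : C(Set.Icc (0 : ℝ) 1, ℂ) →+* ℂ) (F v) := by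
    rw [map_prod]
    refine Finset.prod_congr rfl fun v _ => ?_
    ext g
    rfl
  have h1 : (E.coeff g) s = (hahnMap
      (ContinuousMap.evalAlgHom ℂ ℂ s : C(V → Set.Icc (0 : ℝ) 1, ℂ) →+* ℂ) E).coeff g := rfl
  simp only [hF]
  rw [hahnSeries_prod_smul, HahnSeries.coeff_smul, smul_eq_mul, h1, hE]

end Fraction

section Beta

/-- The beta integral of a primitive `G` of `g` that vanishes at `x`. -/
theorem integral_pow_mul_pow_of_primitive {G g : ℝ → ℂ} {x y : ℝ} (hxy : x ≤ y) {S : Set ℝ}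
    (hS : S.Countable) (hG : ContinuousOn G (Set.Icc x y))
    (hd : ∀ u ∈ Set.Ioo x y \ S, HasDerivAt G (g u) u) (hg : IntervalIntegrable g volume x y)
    (hx : G x = 0) (a b : ℕ) :
    ∫ u in x..y, ((a.factorial : ℂ)⁻¹ * (G y - G u) ^ a) * ((b.factorial : ℂ)⁻¹ * G u ^ b) * g u =
      ((a + b + 1).factorial : ℂ)⁻¹ * G y ^ (a + b + 1) := by
  have hGu : ContinuousOn G (Set.uIcc x y) := by rwa [Set.uIcc_of_le hxy]
  have hfact : ∀ n : ℕ, ((n + 1).factorial : ℂ)⁻¹ * ((n + 1 : ℕ) : ℂ) = (n.factorial : ℂ)⁻¹ := by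
    intro n
    rw [Nat.factorial_succ]
    have h1 : ((n + 1 : ℕ) : ℂ) ≠ 0 := Nat.cast_ne_zero.2 n.succ_ne_zero
    have h2 : (n.factorial : ℂ) ≠ 0 := Nat.cast_ne_zero.2 n.factorial_ne_zero
    push_cast at h1 ⊢
    field_simp
  have hint : ∀ a b : ℕ, IntervalIntegrable (fun u => ((a.factorial : ℂ)⁻¹ * (G y - G u) ^ a) *
      ((b.factorial : ℂ)⁻¹ * G u ^ b) * g u) volume x y := by
    intro a b
    refine hg.continuousOn_mul ?_
    fun_prop
  induction a generalizing b with
  | zero =>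
    have h := integral_eq_of_hasDerivAt_off_countable_of_le
      (fun u => ((b + 1).factorial : ℂ)⁻¹ * G u ^ (b + 1))
      (fun u => (((0 : ℕ).factorial : ℂ)⁻¹ * (G y - G u) ^ 0) * ((b.factorial : ℂ)⁻¹ * G u ^ b) * g u)
      hxy hS (by fun_prop) (fun u hu => ?_) (hint 0 b)
    · rw [h, hx]
      simp
    · convert! ((hd u hu).pow (b + 1)).const_mul ((b + 1).factorial : ℂ)⁻¹ using 1
      rw [← hfact b]
      simp
      ring
  | succ a ih =>
    have h := integral_eq_of_hasDerivAt_off_countable_of_le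
      (fun u => (((a + 1).factorial : ℂ)⁻¹ * (G y - G u) ^ (a + 1)) *
        (((b + 1).factorial : ℂ)⁻¹ * G u ^ (b + 1)))
      (fun u => (((a + 1).factorial : ℂ)⁻¹ * (G y - G u) ^ (a + 1)) *
          ((b.factorial : ℂ)⁻¹ * G u ^ b) * g u -
        ((a.factorial : ℂ)⁻¹ * (G y - G u) ^ a) *
          (((b + 1).factorial : ℂ)⁻¹ * G u ^ (b + 1)) * g u)
      hxy hS (by fun_prop) (fun u hu => ?_) ((hint (a + 1) b).sub (hint a (b + 1)))
    · rw [intervalIntegral.integral_sub (hint (a + 1) b) (hint a (b + 1)), ih (b + 1), hx] at h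
      have h0 : (0 : ℂ) ^ (b + 1) = 0 := by simp
      have h0' : (0 : ℂ) ^ (a + 1) = 0 := by simp
      rw [sub_self, h0, h0', mul_zero, mul_zero, mul_zero, zero_mul, sub_self, sub_eq_zero] at h
      rw [h, show a + 1 + b + 1 = a + (b + 1) + 1 by ring]
    · have h1 := ((((hd u hu).const_sub (G y)).pow (a + 1)).const_mul
        ((a + 1).factorial : ℂ)⁻¹).mul
        (((hd u hu).pow (b + 1)).const_mul ((b + 1).factorial : ℂ)⁻¹)
      convert! h1 using 1
      rw [← hfact b, ← hfact a]
      simp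
      ring

end Beta

section Paths

variable {γ : ℝ → ℂ}

theorem PiecewiseSmooth.exists_finset (h : PiecewiseSmooth γ) :
    ∃ B : Finset ℝ, ∀ t ∈ Set.Ioo (0 : ℝ) 1 \ B,
      DifferentiableAt ℝ γ t ∧ ContinuousAt (deriv γ) t := by
  obtain ⟨-, B, hB⟩ := h
  refine ⟨B, fun t ht => ?_⟩
  have hopen : IsOpen (Set.Ioo (0 : ℝ) 1 \ B) := isOpen_Ioo.sdiff B.finite_toSet.isClosed
  obtain ⟨δ, hδ, hball⟩ := Metric.isOpen_iff.1 hopen t ht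
  rw [Real.ball_eq_Ioo] at hball
  have hsub : Set.Ioo (t - δ) (t + δ) ⊆ Set.Icc (0 : ℝ) 1 := fun u hu =>
    Set.Ioo_subset_Icc_self (hball hu).1
  have hcl := closure_minimal hsub isClosed_Icc
  rw [closure_Ioo (by linarith)] at hcl
  have h1 := hB (t - δ) (t + δ) (hcl ⟨le_rfl, by linarith⟩).1 (by linarith)
    (hcl ⟨by linarith, le_rfl⟩).2 (fun s hs hs' => (hball hs').2 hs)
  have h2 : ContDiffOn ℝ ∞ γ (Set.Ioo (t - δ) (t + δ)) := h1.mono Set.Ioo_subset_Icc_self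
  have htm : Set.Ioo (t - δ) (t + δ) ∈ 𝓝 t := Ioo_mem_nhds (by linarith) (by linarith)
  exact ⟨(h2.contDiffAt htm).differentiableAt (by simp),
    (h2.continuousOn_deriv_of_isOpen isOpen_Ioo (by simp)).continuousAt htm⟩

theorem exists_bound_deriv_of_contDiffOn {a b : ℝ} (hab : a < b)
    (h : ContDiffOn ℝ ∞ γ (Set.Icc a b)) : ∃ C, ∀ t ∈ Set.Ioo a b, ‖deriv γ t‖ ≤ C := by
  have h1 := h.continuousOn_derivWithin (uniqueDiffOn_Icc hab) (by simp)
  obtain ⟨C, hC⟩ := isCompact_Icc.exists_bound_of_continuousOn h1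
  refine ⟨C, fun t ht => ?_⟩
  rw [← derivWithin_of_mem_nhds (Icc_mem_nhds ht.1 ht.2)]
  exact hC t (Set.Ioo_subset_Icc_self ht)

theorem PiecewiseSmooth.exists_bound_deriv (h : PiecewiseSmooth γ) :
    ∃ C, ∀ t ∈ Set.Ioo (0 : ℝ) 1, ‖deriv γ t‖ ≤ C := by
  obtain ⟨-, B, hB⟩ := h
  suffices H : ∃ C, ∀ t ∈ Set.Icc (0 : ℝ) 1, t ∈ Set.Ioo (0 : ℝ) 1 → ‖deriv γ t‖ ≤ C by
    obtain ⟨C, hC⟩ := H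
    exact ⟨C, fun t ht => hC t (Set.Ioo_subset_Icc_self ht) ht⟩
  refine IsCompact.induction_on (s := Set.Icc (0 : ℝ) 1)
    (p := fun S => ∃ C, ∀ t ∈ S, t ∈ Set.Ioo (0 : ℝ) 1 → ‖deriv γ t‖ ≤ C) isCompact_Icc
    ⟨0, by simp⟩ ?_ ?_ ?_
  · rintro s t hst ⟨C, hC⟩
    exact ⟨C, fun u hu => hC u (hst hu)⟩
  · rintro s t ⟨C, hC⟩ ⟨C', hC'⟩
    refine ⟨max C C', fun u hu hu' => ?_⟩
    rcases hu with hu | hu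
    · exact (hC u hu hu').trans (le_max_left _ _)
    · exact (hC' u hu hu').trans (le_max_right _ _)
  · intro x hx
    have hcl : IsClosed ((B.erase x : Finset ℝ) : Set ℝ) := (Finset.finite_toSet _).isClosed
    obtain ⟨δ, hδ, hball⟩ := Metric.isOpen_iff.1 hcl.isOpen_compl x (by simp)
    rw [Real.ball_eq_Ioo] at hball
    have hmem : ∀ u ∈ Set.Ioo (x - δ) (x + δ), u ≠ x → u ∉ B := by
      intro u hu hux huB
      exact hball hu (by simp [hux, huB])
    have hright : ∃ C, ∀ t ∈ Set.Ioo x (x + δ), t ∈ Set.Ioo (0 : ℝ) 1 → ‖deriv γ t‖ ≤ C := by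
      by_cases hx1 : x < 1
      · obtain ⟨C, hC⟩ := exists_bound_deriv_of_contDiffOn (lt_min (by linarith) hx1)
          (hB x (min (x + δ) 1) hx.1 (lt_min (by linarith) hx1) (min_le_right _ _)
            fun s hs hs' => hmem s ⟨by linarith [hs'.1], hs'.2.trans_le (min_le_left _ _)⟩
              hs'.1.ne' hs)
        exact ⟨C, fun t ht ht' => hC t ⟨ht.1, lt_min ht.2 ht'.2⟩⟩
      · exact ⟨0, fun t ht ht' => absurd (ht.1.trans ht'.2) hx1⟩
    have hleft : ∃ C, ∀ t ∈ Set.Ioo (x - δ) x, t ∈ Set.Ioo (0 : ℝ) 1 → ‖deriv γ t‖ ≤ C := by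
      by_cases hx0 : 0 < x
      · obtain ⟨C, hC⟩ := exists_bound_deriv_of_contDiffOn (max_lt (by linarith) hx0)
          (hB (max (x - δ) 0) x (le_max_right _ _) (max_lt (by linarith) hx0) hx.2
            fun s hs hs' => hmem s ⟨(le_max_left _ _).trans_lt hs'.1, by linarith [hs'.2]⟩
              hs'.2.ne hs)
        exact ⟨C, fun t ht ht' => hC t ⟨max_lt ht.1 ht'.1, ht.2⟩⟩
      · exact ⟨0, fun t ht ht' => absurd (ht'.1.trans ht.2) hx0⟩
    obtain ⟨C, hC⟩ := hright
    obtain ⟨C', hC'⟩ := hleft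
    refine ⟨Set.Ioo (x - δ) (x + δ), mem_nhdsWithin_of_mem_nhds
      (Ioo_mem_nhds (by linarith) (by linarith)), max ‖deriv γ x‖ (max C C'), fun t ht ht' => ?_⟩
    rcases lt_trichotomy t x with h | h | h
    · exact (hC' t ⟨ht.1, h⟩ ht').trans ((le_max_right _ _).trans (le_max_right _ _))
    · rw [h]; exact le_max_left _ _
    · exact (hC t ⟨h, ht.2⟩ ht').trans ((le_max_left _ _).trans (le_max_right _ _))

/-- The order of magnitude of `1 / (γ(t) - c)`. -/
def poleBound (γ : ℝ → ℂ) (c : ℂ) (t : ℝ) : ℝ :=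
  (if γ 0 = c then t⁻¹ else 1) * (if γ 1 = c then (1 - t)⁻¹ else 1)

theorem IsPathFromTo.exists_bound_inv_sub {p q : TangentialBasePoint} {M : Set ℂ}
    (h : IsPathFromTo γ p q M) {c : ℂ} (hc : ∀ t ∈ Set.Ioo (0 : ℝ) 1, γ t ≠ c) :
    ∃ K, 0 ≤ K ∧ ∀ t ∈ Set.Ioo (0 : ℝ) 1, ‖(γ t - c)⁻¹‖ ≤ K * poleBound γ c t := by
  have hpos : ∀ t ∈ Set.Ioo (0 : ℝ) 1, 1 ≤ t⁻¹ ∧ 1 ≤ (1 - t)⁻¹ := fun t ht =>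
    ⟨(one_le_inv₀ ht.1).2 ht.2.le, (one_le_inv₀ (by linarith [ht.2])).2 (by linarith [ht.1])⟩
  have hone : ∀ t ∈ Set.Ioo (0 : ℝ) 1, 1 ≤ poleBound γ c t := by
    intro t ht
    obtain ⟨h1, h2⟩ := hpos t ht
    unfold poleBound
    refine one_le_mul_of_one_le_of_one_le ?_ ?_ <;> split_ifs <;> simp [h1, h2]
  suffices H : ∃ K, ∀ t ∈ Set.Icc (0 : ℝ) 1, t ∈ Set.Ioo (0 : ℝ) 1 →
      ‖(γ t - c)⁻¹‖ ≤ K * poleBound γ c t by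
    obtain ⟨K, hK⟩ := H
    refine ⟨max K 0, le_max_right _ _, fun t ht => (hK t (Set.Ioo_subset_Icc_self ht) ht).trans ?_⟩
    exact mul_le_mul_of_nonneg_right (le_max_left _ _) (zero_le_one.trans (hone t ht))
  refine IsCompact.induction_on (s := Set.Icc (0 : ℝ) 1)
    (p := fun S => ∃ K, ∀ t ∈ S, t ∈ Set.Ioo (0 : ℝ) 1 → ‖(γ t - c)⁻¹‖ ≤ K * poleBound γ c t)
    isCompact_Icc ⟨0, by simp⟩ ?_ ?_ ?_
  · rintro s t hst ⟨C, hC⟩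
    exact ⟨C, fun u hu => hC u (hst hu)⟩
  · rintro s t ⟨C, hC⟩ ⟨C', hC'⟩
    refine ⟨max C C', fun u hu hu' => ?_⟩
    have := zero_le_one.trans (hone u hu')
    rcases hu with hu | hu
    · exact (hC u hu hu').trans (mul_le_mul_of_nonneg_right (le_max_left _ _) this)
    · exact (hC' u hu hu').trans (mul_le_mul_of_nonneg_right (le_max_right _ _) this)
  · intro x hx
    suffices H : ∃ K, ∀ᶠ t in 𝓝[Set.Icc 0 1] x, t ∈ Set.Ioo (0 : ℝ) 1 →
        ‖(γ t - c)⁻¹‖ ≤ K * poleBound γ c t by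
      obtain ⟨K, hK⟩ := H
      exact ⟨_, hK, K, fun t ht => ht⟩
    have htangent : ∀ {l : Filter ℝ} {d : ℝ → ℂ} {v : ℂ}, v ≠ 0 →
        Tendsto (fun t => (γ t - c) / d t) l (𝓝 v) →
        ∀ᶠ t in l, ‖(γ t - c)⁻¹‖ ≤ 2 / ‖v‖ * ‖(d t)⁻¹‖ := by
      intro l d v hv hl
      have h1 : ‖v‖ / 2 < ‖v‖ := half_lt_self (norm_pos_iff.2 hv)
      filter_upwards [hl.norm.eventually (lt_mem_nhds h1)] with t ht
      have hv' := norm_pos_iff.2 hv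
      rw [norm_div] at ht
      have hd : 0 < ‖d t‖ := by
        by_contra h0
        have : ‖d t‖ = 0 := le_antisymm (not_lt.1 h0) (norm_nonneg _)
        rw [this, div_zero] at ht
        linarith
      rw [lt_div_iff₀ hd] at ht
      rw [norm_inv, norm_inv, div_mul_eq_mul_div, le_div_iff₀ hv', inv_mul_le_iff₀ (by nlinarith)]
      rw [← div_eq_mul_inv, ← mul_div_assoc, le_div_iff₀ hd]
      linarith
    by_cases hxc : γ x = c
    · have hx01 : x = 0 ∨ x = 1 := by
        by_contra! hne
        exact hc x ⟨lt_of_le_of_ne hx.1 hne.1.symm, lt_of_le_of_ne hx.2 hne.2⟩ hxc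
      rcases hx01 with rfl | rfl
      · have h1 := h.tangent_source
        rw [← h.source, hxc] at h1
        refine ⟨2 / ‖p.vec‖, ?_⟩
        have h2 := eventually_nhdsWithin_iff.1 (htangent p.vec_ne_zero h1)
        filter_upwards [mem_nhdsWithin_of_mem_nhds h2] with t ht ht'
        refine (ht ht'.1).trans (mul_le_mul_of_nonneg_left ?_ (by positivity))
        obtain ⟨h3, h4⟩ := hpos t ht'
        unfold poleBound
        rw [if_pos hxc, norm_inv, Complex.norm_real, Real.norm_of_nonneg ht'.1.le]
        exact le_mul_of_one_le_right (by linarith) (by split_ifs <;> simp [h4])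
      · have h1 := h.tangent_target
        rw [← h.target, hxc] at h1
        refine ⟨2 / ‖-q.vec‖, ?_⟩
        have h2 := eventually_nhdsWithin_iff.1 (htangent (neg_ne_zero.2 q.vec_ne_zero) h1)
        filter_upwards [mem_nhdsWithin_of_mem_nhds h2] with t ht ht'
        refine (ht ht'.2).trans (mul_le_mul_of_nonneg_left ?_ (by positivity))
        obtain ⟨h3, h4⟩ := hpos t ht'
        unfold poleBound
        have h5 : ‖((t : ℂ) - 1)‖ = 1 - t := by
          rw [← Complex.ofReal_one, ← Complex.ofReal_sub, Complex.norm_real, Real.norm_eq_abs,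
            abs_of_neg (by linarith [ht'.2])]
          ring
        rw [if_pos hxc, norm_inv, h5]
        exact le_mul_of_one_le_left (by linarith) (by split_ifs <;> simp [h3])
    · have h1 : Tendsto (fun t => ‖(γ t - c)⁻¹‖) (𝓝[Set.Icc 0 1] x) (𝓝 ‖(γ x - c)⁻¹‖) :=
        (((h.piecewiseSmooth.1 x hx).tendsto.sub_const c).inv₀ (sub_ne_zero.2 hxc)).norm
      refine ⟨‖(γ x - c)⁻¹‖ + 1, ?_⟩
      filter_upwards [h1.eventually (gt_mem_nhds (lt_add_one _))] with t ht ht'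
      exact ht.le.trans (le_mul_of_one_le_right (by positivity) (hone t ht'))

end Paths

/-- The integrand of the beta integral with equal exponents. -/
def betaKernel (δ t : ℝ) : ℝ := t ^ (δ - 1) * (1 - t) ^ (δ - 1)

theorem integrableOn_betaKernel {δ : ℝ} (hδ : 0 < δ) :
    IntegrableOn (betaKernel δ) (Set.Ioo 0 1) := by
  have h := (Complex.betaIntegral_convergent (u := δ) (v := δ) (by simpa) (by simpa)).norm
  rw [intervalIntegrable_iff_integrableOn_Ioo_of_le zero_le_one] at h
  refine h.congr_fun (fun t ht => ?_) measurableSet_Ioo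
  have h1 : 0 < 1 - t := by linarith [ht.2]
  simp only [betaKernel, norm_mul]
  rw [Complex.norm_cpow_eq_rpow_re_of_pos ht.1, show (1 : ℂ) - t = ((1 - t : ℝ) : ℂ) by simp,
    Complex.norm_cpow_eq_rpow_re_of_pos h1]
  simp

theorem betaKernel_nonneg {δ t : ℝ} (ht : t ∈ Set.Ioo (0 : ℝ) 1) : 0 ≤ betaKernel δ t :=
  mul_nonneg (Real.rpow_nonneg ht.1.le _) (Real.rpow_nonneg (by linarith [ht.2]) _)

section Paths

variable {γ : ℝ → ℂ} {p q : TangentialBasePoint} {M : Set ℂ}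

theorem IsPathFromTo.exists_bound_logDeriv (h : IsPathFromTo γ p q M)
    (h0 : ∀ t ∈ Set.Ioo (0 : ℝ) 1, γ t ≠ 0) :
    ∃ C, 0 ≤ C ∧ ∀ t ∈ Set.Ioo (0 : ℝ) 1, ‖deriv γ t / γ t‖ ≤ C * (t⁻¹ * (1 - t)⁻¹) := by
  obtain ⟨C, hC⟩ := h.piecewiseSmooth.exists_bound_deriv
  obtain ⟨K, hK0, hK⟩ := h.exists_bound_inv_sub h0
  have hC0 : 0 ≤ C := (norm_nonneg _).trans (hC (1 / 2) (by norm_num))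
  refine ⟨C * K, by positivity, fun t ht => ?_⟩
  have h1 : 1 ≤ t⁻¹ := (one_le_inv₀ ht.1).2 ht.2.le
  have h2 : 1 ≤ (1 - t)⁻¹ := (one_le_inv₀ (by linarith [ht.2])).2 (by linarith [ht.1])
  have h3 : poleBound γ 0 t ≤ t⁻¹ * (1 - t)⁻¹ := by
    unfold poleBound
    refine mul_le_mul ?_ ?_ ?_ (by linarith) <;> split_ifs <;> linarith
  have h4 := hK t ht
  rw [sub_zero] at h4
  rw [div_eq_mul_inv, norm_mul, mul_assoc]
  exact mul_le_mul (hC t ht) (h4.trans (mul_le_mul_of_nonneg_left h3 hK0)) (norm_nonneg _) hC0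

theorem IsPathFromTo.aestronglyMeasurable_logDeriv (h : IsPathFromTo γ p q M)
    (h0 : ∀ t ∈ Set.Ioo (0 : ℝ) 1, γ t ≠ 0) {S : Set ℝ} (hS : MeasurableSet S)
    (hS' : S ⊆ Set.Ioo 0 1) :
    AEStronglyMeasurable (fun u => deriv γ u / γ u) (volume.restrict S) := by
  simp only [div_eq_mul_inv]
  exact (measurable_deriv γ).aestronglyMeasurable.mul
    (((h.piecewiseSmooth.1.mono (hS'.trans Set.Ioo_subset_Icc_self)).inv₀
      fun t ht => h0 t (hS' ht)).aestronglyMeasurable hS)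

theorem IsPathFromTo.intervalIntegrable_logDeriv (h : IsPathFromTo γ p q M)
    (h0 : ∀ t ∈ Set.Ioo (0 : ℝ) 1, γ t ≠ 0) {x y : ℝ} (hx : x ∈ Set.Ioo (0 : ℝ) 1)
    (hy : y ∈ Set.Ioo (0 : ℝ) 1) :
    IntervalIntegrable (fun u => deriv γ u / γ u) volume x y := by
  wlog hxy : x ≤ y generalizing x y
  · exact (this hy hx (le_of_not_ge hxy)).symm
  obtain ⟨C, hC0, hC⟩ := h.exists_bound_logDeriv h0
  rw [intervalIntegrable_iff_integrableOn_Icc_of_le hxy]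
  have hsub : Set.Icc x y ⊆ Set.Ioo 0 1 := fun u hu => ⟨hx.1.trans_le hu.1, hu.2.trans_lt hy.2⟩
  refine IntegrableOn.of_bound (C := C * (x⁻¹ * (1 - y)⁻¹)) (by simp) ?_ ?_
  · exact h.aestronglyMeasurable_logDeriv h0 measurableSet_Icc hsub
  · refine ae_restrict_of_forall_mem measurableSet_Icc fun u hu => (hC u (hsub hu)).trans ?_
    have h1 : 0 < 1 - y := by linarith [hy.2]
    have h2 : 0 < 1 - u := by linarith [hu.2]
    refine mul_le_mul_of_nonneg_left (mul_le_mul ?_ ?_ ?_ ?_) hC0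
    · exact inv_anti₀ hx.1 hu.1
    · exact inv_anti₀ h1 (by linarith [hu.2])
    · exact inv_nonneg.2 h2.le
    · exact inv_nonneg.2 hx.1.le

theorem IsPathFromTo.exists_bound_logDiff (h : IsPathFromTo γ p q M)
    (h0 : ∀ t ∈ Set.Ioo (0 : ℝ) 1, γ t ≠ 0) {δ : ℝ} (hδ : 0 < δ) :
    ∃ K, 0 ≤ K ∧ ∀ s t, 0 < s → s ≤ t → t < 1 →
      ‖logDiff γ s t‖ ≤ K * (s ^ (-δ) * (1 - t) ^ (-δ)) := by
  obtain ⟨C, hC0, hC⟩ := h.exists_bound_logDeriv h0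
  have hI : 0 ≤ ∫ u in Set.Ioo (0 : ℝ) 1, betaKernel δ u :=
    setIntegral_nonneg measurableSet_Ioo fun u hu => betaKernel_nonneg hu
  refine ⟨C * ∫ u in Set.Ioo (0 : ℝ) 1, betaKernel δ u, by positivity, fun s t hs hst ht => ?_⟩
  have hsub : Set.Ioc s t ⊆ Set.Ioo 0 1 := fun u hu => ⟨hs.trans hu.1, hu.2.trans_lt ht⟩
  have hint : IntegrableOn (betaKernel δ) (Set.Ioc s t) := (integrableOn_betaKernel hδ).mono_set hsub
  have hpow : ∀ {a b : ℝ}, 0 < a → a ≤ b → b⁻¹ ≤ a ^ (-δ) * b ^ (δ - 1) := by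
    intro a b ha hab
    have hb : 0 < b := ha.trans_le hab
    calc b⁻¹ = b ^ (-δ) * b ^ (δ - 1) := by
          rw [← Real.rpow_add hb, ← Real.rpow_neg_one]; congr 1; ring
      _ ≤ a ^ (-δ) * b ^ (δ - 1) := mul_le_mul_of_nonneg_right
          (Real.rpow_le_rpow_of_nonpos ha hab (by linarith)) (Real.rpow_nonneg hb.le _)
  unfold logDiff
  calc ‖∫ u in s..t, deriv γ u / γ u‖
      ≤ ∫ u in s..t, C * (s ^ (-δ) * (1 - t) ^ (-δ)) * betaKernel δ u := by
        refine intervalIntegral.norm_integral_le_of_norm_le hst (ae_of_all _ fun u hu => ?_) ?_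
        · refine (hC u (hsub hu)).trans ?_
          rw [mul_assoc]
          refine mul_le_mul_of_nonneg_left ?_ hC0
          have h1 := hpow hs hu.1.le
          have h2 := hpow (show 0 < 1 - t by linarith) (show 1 - t ≤ 1 - u by linarith [hu.2])
          have h3 : 0 < 1 - u := by linarith [hu.2]
          have h4 : 0 < u := hs.trans hu.1
          calc u⁻¹ * (1 - u)⁻¹ ≤ (s ^ (-δ) * u ^ (δ - 1)) * ((1 - t) ^ (-δ) * (1 - u) ^ (δ - 1)) :=
                mul_le_mul h1 h2 (inv_nonneg.2 h3.le) (by positivity)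
            _ = _ := by unfold betaKernel; ring
        · rw [intervalIntegrable_iff_integrableOn_Ioc_of_le hst]
          exact hint.const_mul _
    _ = C * (s ^ (-δ) * (1 - t) ^ (-δ)) * ∫ u in Set.Ioc s t, betaKernel δ u := by
        rw [intervalIntegral.integral_const_mul, intervalIntegral.integral_of_le hst]
    _ ≤ C * (s ^ (-δ) * (1 - t) ^ (-δ)) * ∫ u in Set.Ioo (0 : ℝ) 1, betaKernel δ u := by
        have h1t : 0 < 1 - t := by linarith
        refine mul_le_mul_of_nonneg_left ?_ (by positivity)
        exact setIntegral_mono_set (integrableOn_betaKernel hδ)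
          (ae_restrict_of_forall_mem measurableSet_Ioo fun u hu => betaKernel_nonneg hu)
          hsub.eventuallyLE
    _ = _ := by ring

/-- A continuous branch of the logarithm along `γ`. -/
theorem IsPathFromTo.exists_log (h : IsPathFromTo γ p q M)
    (h0 : ∀ t ∈ Set.Ioo (0 : ℝ) 1, γ t ≠ 0) :
    ∃ Λ : ℝ → ℂ, ContinuousOn Λ (Set.Ioo 0 1) ∧
      ∀ s ∈ Set.Ioo (0 : ℝ) 1, ∀ t ∈ Set.Ioo (0 : ℝ) 1, logDiff γ s t = Λ t - Λ s := by
  have hhalf : (1 / 2 : ℝ) ∈ Set.Ioo (0 : ℝ) 1 := by norm_num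
  refine ⟨fun t => ∫ u in (1 / 2 : ℝ)..t, deriv γ u / γ u, ?_, fun s hs t ht => ?_⟩
  · intro x hx
    refine ContinuousAt.continuousWithinAt ?_
    let a := min (x / 2) (1 / 2)
    let b := max ((x + 1) / 2) (1 / 2)
    have ha : a ∈ Set.Ioo (0 : ℝ) 1 :=
      ⟨lt_min (by linarith [hx.1]) (by norm_num), (min_le_right _ _).trans_lt (by norm_num)⟩
    have hb : b ∈ Set.Ioo (0 : ℝ) 1 :=
      ⟨lt_max_of_lt_right (by norm_num), max_lt (by linarith [hx.2]) (by norm_num)⟩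
    have hab : a ≤ b := (min_le_right _ _).trans (le_max_right _ _)
    have hcont := intervalIntegral.continuousOn_primitive_interval'
      (h.intervalIntegrable_logDeriv h0 ha hb) (a := 1 / 2)
      (by rw [Set.uIcc_of_le hab]; exact ⟨min_le_right _ _, le_max_right _ _⟩)
    rw [Set.uIcc_of_le hab] at hcont
    refine hcont.continuousAt (Icc_mem_nhds ?_ ?_)
    · exact (min_le_left _ _).trans_lt (by linarith [hx.1])
    · exact lt_of_lt_of_le (by linarith [hx.2]) (le_max_left _ _)
  · have := intervalIntegral.integral_add_adjacent_intervals
      (h.intervalIntegrable_logDeriv h0 hhalf hs) (h.intervalIntegrable_logDeriv h0 hs ht)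
    exact eq_sub_of_add_eq' this

theorem IsPathFromTo.integral_logDiff_pow (h : IsPathFromTo γ p q M)
    (h0 : ∀ t ∈ Set.Ioo (0 : ℝ) 1, γ t ≠ 0) {x y : ℝ} (hx : 0 < x) (hxy : x < y) (hy : y < 1)
    (a b : ℕ) :
    ∫ u in x..y, ((a.factorial : ℂ)⁻¹ * logDiff γ u y ^ a) *
        ((b.factorial : ℂ)⁻¹ * logDiff γ x u ^ b) * (deriv γ u / γ u) =
      ((a + b + 1).factorial : ℂ)⁻¹ * logDiff γ x y ^ (a + b + 1) := by
  obtain ⟨B, hB⟩ := h.piecewiseSmooth.exists_finset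
  have hx' : x ∈ Set.Ioo (0 : ℝ) 1 := ⟨hx, hxy.trans hy⟩
  have hy' : y ∈ Set.Ioo (0 : ℝ) 1 := ⟨hx.trans hxy, hy⟩
  have hsub : Set.Icc x y ⊆ Set.Ioo 0 1 := fun u hu => ⟨hx.trans_le hu.1, hu.2.trans_lt hy⟩
  have hI := h.intervalIntegrable_logDeriv h0 hx' hy'
  have hcont : ContinuousOn (logDiff γ x) (Set.Icc x y) := by
    have := intervalIntegral.continuousOn_primitive_interval' hI Set.left_mem_uIcc
    rwa [Set.uIcc_of_le hxy.le] at this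
  rw [← integral_pow_mul_pow_of_primitive hxy.le B.countable_toSet hcont (fun u hu => ?_) hI
    (by simp [logDiff]) a b]
  · refine intervalIntegral.integral_congr fun u hu => ?_
    rw [Set.uIcc_of_le hxy.le] at hu
    have : logDiff γ x y - logDiff γ x u = logDiff γ u y := by
      have := intervalIntegral.integral_add_adjacent_intervals
        (h.intervalIntegrable_logDeriv h0 hx' (hsub hu))
        (h.intervalIntegrable_logDeriv h0 (hsub hu) hy')
      unfold logDiff
      rw [← this]
      ring
    simp only [this]
  · have hu' : u ∈ Set.Ioo (0 : ℝ) 1 := hsub (Set.Ioo_subset_Icc_self hu.1)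
    obtain ⟨h1, h2⟩ := hB u ⟨hu', hu.2⟩
    have hm : StronglyMeasurableAtFilter (fun u => deriv γ u / γ u) (𝓝 u) :=
      ⟨Set.Ioo 0 1, Ioo_mem_nhds hu'.1 hu'.2,
        h.aestronglyMeasurable_logDeriv h0 measurableSet_Ioo subset_rfl⟩
    exact intervalIntegral.integral_hasDerivAt_right (h.intervalIntegrable_logDeriv h0 hx' hu') hm
      (h2.div h1.continuousAt (h0 u hu'))

end Paths

namespace PosTree

variable {r : ℕ} {V : Type u} (N : PosTree r V)

theorem le_par {s : V → ℝ} (hs : s ∈ N.domain) (v : V) : s v ≤ s (N.par v) := by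
  by_cases hv : v = N.root
  · rw [hv, N.par_root]
  · exact (hs.2 v hv).le

theorem le_root [Finite V] {s : V → ℝ} (hs : s ∈ N.domain) (v : V) : s v ≤ s N.root := by
  have : Nonempty V := ⟨v⟩
  obtain ⟨w, hw⟩ := Finite.exists_max s
  by_cases h : w = N.root
  · exact h ▸ hw v
  · exact absurd (hw (N.par w)) (not_le.2 (hs.2 w h))

open Classical in
/-- The smallest coordinate of a point of the domain belongs to a leaf. -/
theorem prod_leaf_le [Fintype V] {s : V → ℝ} (hs : s ∈ N.domain) (v : V) :
    ∏ w with N.children w = ∅, s w ≤ s v := by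
  have : Nonempty V := ⟨v⟩
  obtain ⟨w, hw⟩ := Finite.exists_min s
  have hleaf : N.children w = ∅ := by
    rw [Set.eq_empty_iff_forall_notMem]
    rintro x ⟨hx, rfl⟩
    exact absurd (hw x) (not_le.2 (hs.2 x hx))
  refine le_trans ?_ (hw v)
  have hmem : w ∈ Finset.univ.filter fun w => N.children w = ∅ := by simp [hleaf]
  rw [← Finset.mul_prod_erase _ _ hmem]
  exact mul_le_of_le_one_right (hs.1 w).1.le
    (Finset.prod_le_one (fun x _ => (hs.1 x).1.le) fun x _ => (hs.1 x).2.le)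

open Classical in
/-- The order of magnitude of the factor of `v`, apart from powers with small exponents. -/
def weight (s : V → ℝ) (v : V) : ℝ :=
  (if N.children v = ∅ then 1 else (s v)⁻¹) * (if v = N.root then 1 else (1 - s v)⁻¹)

theorem weight_nonneg {s : V → ℝ} (hs : s ∈ N.domain) (v : V) : 0 ≤ N.weight s v := by
  have h1 := (hs.1 v).1
  have h2 : 0 < 1 - s v := by linarith [(hs.1 v).2]
  unfold weight
  refine mul_nonneg ?_ ?_ <;> split_ifs <;> positivity

/-- Powers of the coordinates of leaves absorb the borderline exponents of the inner vertices. -/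
theorem prod_weight_le [Fintype V] {s : V → ℝ} (hs : s ∈ N.domain) {ε : ℝ} (hε : 0 < ε)
    (hcard : 2 * ε * Fintype.card V = 1 - ε) :
    ∏ v, ((s v) ^ (-ε) * (1 - s (N.par v)) ^ (-ε) * N.weight s v) ≤
      ∏ v, betaKernel ε (s v) := by
  classical
  set μ : ℝ := ∏ w with N.children w = ∅, s w with hμ
  set ρ : ℝ := 1 - s N.root with hρ
  have hμ0 : 0 < μ := Finset.prod_pos fun w _ => (hs.1 w).1
  have hρ0 : 0 < ρ := by linarith [(hs.1 N.root).2]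
  have hμ1 : μ ≤ 1 := Finset.prod_le_one (fun w _ => (hs.1 w).1.le) fun w _ => (hs.1 w).2.le
  have hρ1 : ρ ≤ 1 := by linarith [(hs.1 N.root).1]
  have hsmall : ∀ {a b : ℝ}, 0 < a → a ≤ b → b ^ (-ε) ≤ a ^ (-ε) := fun ha hab =>
    Real.rpow_le_rpow_of_nonpos ha hab (by linarith)
  have hone : ∀ {a : ℝ}, 0 < a → a ≤ 1 → 1 ≤ a ^ (-ε) := fun ha ha1 =>
    Real.one_le_rpow_of_pos_of_le_one_of_nonpos ha ha1 (by linarith)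
  have hinv : ∀ {a b : ℝ}, 0 < a → a ≤ b → b⁻¹ ≤ b ^ (ε - 1) * a ^ (-ε) := by
    intro a b ha hab
    have hb : 0 < b := ha.trans_le hab
    calc b⁻¹ = b ^ (ε - 1) * b ^ (-ε) := by
          rw [← Real.rpow_add hb, ← Real.rpow_neg_one]; congr 1; ring
      _ ≤ _ := mul_le_mul_of_nonneg_left (hsmall ha hab) (Real.rpow_nonneg hb.le _)
  have hmain : ∀ v, (s v) ^ (-ε) * (1 - s (N.par v)) ^ (-ε) * N.weight s v ≤
      (μ ^ (-ε) * μ ^ (-ε)) * (ρ ^ (-ε) * ρ ^ (-ε)) *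
        ((if N.children v = ∅ then 1 else (s v) ^ (ε - 1)) *
          (if v = N.root then 1 else (1 - s v) ^ (ε - 1))) := by
    intro v
    have hv0 := (hs.1 v).1
    have hv1 : 0 < 1 - s v := by linarith [(hs.1 v).2]
    have hp1 : 0 < 1 - s (N.par v) := by linarith [(hs.1 (N.par v)).2]
    have h1 := hsmall hμ0 (N.prod_leaf_le hs v)
    have h2 := hsmall hρ0 (show ρ ≤ 1 - s (N.par v) by linarith [N.le_root hs (N.par v)])
    have h3 : (if N.children v = ∅ then 1 else (s v)⁻¹) ≤
        (if N.children v = ∅ then 1 else (s v) ^ (ε - 1)) * μ ^ (-ε) := by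
      split_ifs
      · rw [one_mul]; exact hone hμ0 hμ1
      · exact hinv hμ0 (N.prod_leaf_le hs v)
    have h4 : (if v = N.root then 1 else (1 - s v)⁻¹) ≤
        (if v = N.root then 1 else (1 - s v) ^ (ε - 1)) * ρ ^ (-ε) := by
      split_ifs
      · rw [one_mul]; exact hone hρ0 hρ1
      · exact hinv hρ0 (by linarith [N.le_root hs v])
    have h5 : (0 : ℝ) ≤ if v = N.root then 1 else (1 - s v)⁻¹ := by split_ifs <;> positivity
    have h6 : (0 : ℝ) ≤ if N.children v = ∅ then 1 else (s v) ^ (ε - 1) := by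
      split_ifs <;> positivity
    calc (s v) ^ (-ε) * (1 - s (N.par v)) ^ (-ε) * N.weight s v
        ≤ (μ ^ (-ε) * ρ ^ (-ε)) *
          (((if N.children v = ∅ then 1 else (s v) ^ (ε - 1)) * μ ^ (-ε)) *
            ((if v = N.root then 1 else (1 - s v) ^ (ε - 1)) * ρ ^ (-ε))) :=
          mul_le_mul (mul_le_mul h1 h2 (by positivity) (by positivity))
            (mul_le_mul h3 h4 h5 (by positivity)) (N.weight_nonneg hs v) (by positivity)
      _ = _ := by ring
  have hnn : ∀ v, 0 ≤ (s v) ^ (-ε) * (1 - s (N.par v)) ^ (-ε) * N.weight s v := by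
    intro v
    have hv0 := (hs.1 v).1
    have hp1 : 0 < 1 - s (N.par v) := by linarith [(hs.1 (N.par v)).2]
    have := N.weight_nonneg hs v
    positivity
  refine (Finset.prod_le_prod (fun v _ => hnn v) fun v _ => hmain v).trans (le_of_eq ?_)
  rw [Finset.prod_mul_distrib, Finset.prod_const, Finset.card_univ, Finset.prod_mul_distrib]
  have hpow : ∀ {a : ℝ}, 0 < a → (a ^ (-ε) * a ^ (-ε)) ^ Fintype.card V = a ^ (ε - 1) := by
    intro a ha
    rw [← Real.rpow_add ha, ← Real.rpow_natCast, ← Real.rpow_mul ha.le]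
    congr 1
    linarith
  rw [mul_pow, hpow hμ0, hpow hρ0]
  have hA : μ ^ (ε - 1) * ∏ v, (if N.children v = ∅ then 1 else (s v) ^ (ε - 1)) =
      ∏ v, (s v) ^ (ε - 1) := by
    rw [hμ, ← Real.finsetProd_rpow _ _ (fun w _ => (hs.1 w).1.le), Finset.prod_filter,
      ← Finset.prod_mul_distrib]
    refine Finset.prod_congr rfl fun v _ => ?_
    split_ifs <;> simp
  have hB : ρ ^ (ε - 1) * ∏ v, (if v = N.root then 1 else (1 - s v) ^ (ε - 1)) =
      ∏ v, (1 - s v) ^ (ε - 1) := by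
    have : ρ ^ (ε - 1) = ∏ v, if v = N.root then (1 - s v) ^ (ε - 1) else 1 := by
      rw [Finset.prod_ite_eq' Finset.univ N.root, if_pos (Finset.mem_univ _)]
    rw [this, ← Finset.prod_mul_distrib]
    refine Finset.prod_congr rfl fun v _ => ?_
    split_ifs <;> simp
  simp only [betaKernel, Finset.prod_mul_distrib]
  rw [← hA, ← hB]
  ring

variable {γ : ℝ → ℂ} {p q : TangentialBasePoint} {M : Set ℂ}

theorem exists_bound_scalar_mul_pole (h : IsPathFromTo γ p q M)
    (h0 : ∀ t ∈ Set.Ioo (0 : ℝ) 1, γ t ≠ 0) (v : V)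
    (hc : ∀ c, N.color v = LaurentPoly.const r c → ∀ t ∈ Set.Ioo (0 : ℝ) 1, γ t ≠ c)
    (hleaf : N.children v = ∅ → N.color v ≠ LaurentPoly.const r (γ 0))
    (hroot : v = N.root → N.color v ≠ LaurentPoly.const r (γ 1)) {ε : ℝ} (hε : 0 < ε) :
    ∃ K, 0 ≤ K ∧ ∀ s ∈ N.domain, ‖N.scalar γ s v * pole (N.color v) (γ (s v))‖ ≤
      K * ((s v) ^ (-ε) * (1 - s (N.par v)) ^ (-ε) * N.weight s v) := by
  obtain ⟨C, hC⟩ := h.piecewiseSmooth.exists_bound_deriv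
  have hC0 : 0 ≤ C := (norm_nonneg _).trans (hC (1 / 2) (by norm_num))
  set j := N.idx v - 1 with hj
  have hδ : 0 < ε / (j + 1) := by positivity
  obtain ⟨L, hL0, hL⟩ := h.exists_bound_logDiff h0 hδ
  have hpole : ∃ K, 0 ≤ K ∧ ∀ s ∈ N.domain,
      ‖pole (N.color v) (γ (s v))‖ ≤ K * N.weight s v := by
    have hinv : ∀ s ∈ N.domain, 1 ≤ (s v)⁻¹ ∧ 1 ≤ (1 - s v)⁻¹ := fun s hs =>
      ⟨(one_le_inv₀ (hs.1 v).1).2 (hs.1 v).2.le,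
        (one_le_inv₀ (by linarith [(hs.1 v).2])).2 (by linarith [(hs.1 v).1])⟩
    by_cases hcol : ∃ c, N.color v = LaurentPoly.const r c
    · obtain ⟨c, hcv⟩ := hcol
      obtain ⟨K, hK0, hK⟩ := h.exists_bound_inv_sub (hc c hcv)
      refine ⟨K, hK0, fun s hs => ?_⟩
      rw [hcv, pole_const]
      refine (hK _ (hs.1 v)).trans (mul_le_mul_of_nonneg_left ?_ hK0)
      obtain ⟨h1, h2⟩ := hinv s hs
      unfold poleBound weight
      refine mul_le_mul ?_ ?_ ?_ ?_
      · by_cases hl : N.children v = ∅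
        · rw [if_neg (fun h => hleaf hl (by rw [hcv, h])), if_pos hl]
        · rw [if_neg hl]; split_ifs <;> linarith
      · by_cases hr : v = N.root
        · rw [if_neg (fun h => hroot hr (by rw [hcv, h])), if_pos hr]
        · rw [if_neg hr]; split_ifs <;> linarith
      · split_ifs <;> linarith
      · split_ifs <;> linarith
    · refine ⟨1, zero_le_one, fun s hs => ?_⟩
      obtain ⟨h1, h2⟩ := hinv s hs
      rw [pole_of_not_const hcol, norm_one, one_mul]
      unfold weight
      refine one_le_mul_of_one_le_of_one_le ?_ ?_ <;> split_ifs <;> linarith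
  obtain ⟨K, hK0, hK⟩ := hpole
  refine ⟨‖((j.factorial : ℂ))⁻¹‖ * L ^ j * C * K, by positivity, fun s hs => ?_⟩
  have hv0 := (hs.1 v).1
  have hv1 := (hs.1 v).2
  have hp0 : 0 < 1 - s (N.par v) := by linarith [(hs.1 (N.par v)).2]
  have hp1 : 1 - s (N.par v) ≤ 1 := by linarith [(hs.1 (N.par v)).1]
  have hlog := hL _ _ hv0 (N.le_par hs v) (hs.1 (N.par v)).2
  have hpow : ∀ {a : ℝ}, 0 < a → a ≤ 1 → (a ^ (-(ε / (j + 1)))) ^ j ≤ a ^ (-ε) := by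
    intro a ha ha1
    rw [← Real.rpow_natCast, ← Real.rpow_mul ha.le]
    refine Real.rpow_le_rpow_of_exponent_ge ha ha1 ?_
    rw [neg_mul, neg_le_neg_iff, div_mul_eq_mul_div, div_le_iff₀ (by positivity)]
    nlinarith
  have hlogj : ‖logDiff γ (s v) (s (N.par v))‖ ^ j ≤
      L ^ j * ((s v) ^ (-ε) * (1 - s (N.par v)) ^ (-ε)) := by
    refine (pow_le_pow_left₀ (norm_nonneg _) hlog j).trans ?_
    rw [mul_pow, mul_pow]
    refine mul_le_mul_of_nonneg_left ?_ (by positivity)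
    exact mul_le_mul (hpow hv0 hv1.le) (hpow hp0 hp1) (by positivity) (by positivity)
  have hw := N.weight_nonneg hs v
  unfold scalar
  rw [← hj, norm_mul, norm_mul, norm_mul, norm_pow]
  calc ‖((j.factorial : ℂ))⁻¹‖ * ‖logDiff γ (s v) (s (N.par v))‖ ^ j * ‖deriv γ (s v)‖ *
        ‖pole (N.color v) (γ (s v))‖
      ≤ ‖((j.factorial : ℂ))⁻¹‖ * (L ^ j * ((s v) ^ (-ε) * (1 - s (N.par v)) ^ (-ε))) * C *
        (K * N.weight s v) := by
        gcongr
        · exact hC _ (hs.1 v)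
        · exact hK s hs
    _ = _ := by ring

variable {Γ : Type} [AddCommGroup Γ] [LinearOrder Γ] [IsOrderedAddMonoid Γ] [Fintype V]

theorem converges (mon : (Fin r → ℤ) ≃+ Γ) (h : IsPathFromTo γ p q M)
    (h0 : ∀ t ∈ Set.Ioo (0 : ℝ) 1, γ t ≠ 0)
    (hreg : ∀ v, (∀ c, N.color v ≠ LaurentPoly.const r c) → RegularAlong mon γ (N.color v))
    (hc : ∀ v c, N.color v = LaurentPoly.const r c → ∀ t ∈ Set.Ioo (0 : ℝ) 1, γ t ≠ c)
    (hleaf : ∀ v, N.children v = ∅ → N.color v ≠ LaurentPoly.const r (γ 0))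
    (hroot : N.color N.root ≠ LaurentPoly.const r (γ 1)) : N.Converges mon γ := by
  intro m
  obtain ⟨f, hf⟩ := exists_coeff_prod_fraction mon h.piecewiseSmooth.1 N.color hreg (mon m)
  let P : (V → ℝ) → (V → Set.Icc (0 : ℝ) 1) := fun s v => Set.projIcc 0 1 zero_le_one (s v)
  have hP : Continuous P := continuous_pi fun v => continuous_projIcc.comp (continuous_apply v)
  have hPs : ∀ s ∈ N.domain, ∀ v, ((P s v : Set.Icc (0 : ℝ) 1) : ℝ) = s v := fun s hs v =>
    congrArg Subtype.val (Set.projIcc_of_mem zero_le_one (Set.Ioo_subset_Icc_self (hs.1 v)))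
  have hint : ∀ s ∈ N.domain, N.integrand mon γ m s =
      (∏ v, N.scalar γ s v * pole (N.color v) (γ (s v))) * f (P s) := by
    intro s hs
    rw [integrand_eq_mul, Finset.prod_mul_distrib, mul_assoc]
    have := hf (P s)
    simp only [hPs s hs] at this
    rw [this]
  set ε : ℝ := 1 / (2 * Fintype.card V + 1) with hεdef
  have hε : 0 < ε := by positivity
  have hcard : 2 * ε * Fintype.card V = 1 - ε := by
    rw [hεdef]; field_simp; ring
  choose K hK0 hK using fun v => N.exists_bound_scalar_mul_pole h h0 v (hc v) (hleaf v)
    (fun hv => by rw [hv]; exact hroot) hε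
  have hdom : Integrable (fun s : V → ℝ => ((∏ v, K v) * ‖f‖) *
      ∏ v, (Set.Ioo (0 : ℝ) 1).indicator (betaKernel ε) (s v)) := by
    refine Integrable.const_mul ?_ _
    exact Integrable.fintype_prod (f := fun _ : V => (Set.Ioo (0 : ℝ) 1).indicator (betaKernel ε))
      (μ := fun _ => volume)
      fun _ => (integrable_indicator_iff measurableSet_Ioo).2 (integrableOn_betaKernel hε)
  refine Integrable.mono' hdom.integrableOn ?_ ?_
  · obtain ⟨Λ, hΛ, hlog⟩ := h.exists_log h0
    let F : (V → ℝ) → ℂ := fun s => (∏ v, (((N.idx v - 1).factorial : ℂ)⁻¹ *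
      (Λ (s (N.par v)) - Λ (s v)) ^ (N.idx v - 1)) * pole (N.color v) (γ (s v))) * f (P s)
    have hcoord : ∀ {g : ℝ → ℂ}, ContinuousOn g (Set.Ioo 0 1) → ∀ v,
        ContinuousOn (fun s : V → ℝ => g (s v)) N.domain := fun hg v =>
      hg.comp (continuous_apply v).continuousOn fun s hs => hs.1 v
    have hF : ContinuousOn F N.domain := by
      refine ContinuousOn.mul (continuousOn_finsetProd _ fun v _ => ?_)
        (f.continuous.comp hP).continuousOn
      refine ContinuousOn.mul (continuousOn_const.mul
        (((hcoord hΛ (N.par v)).sub (hcoord hΛ v)).pow _)) ?_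
      refine hcoord (g := fun t => pole (N.color v) (γ t)) ?_ v
      by_cases hcol : ∃ c, N.color v = LaurentPoly.const r c
      · obtain ⟨c, hcv⟩ := hcol
        simp only [hcv, pole_const]
        exact ((h.piecewiseSmooth.1.mono Set.Ioo_subset_Icc_self).sub continuousOn_const).inv₀
          fun t ht => sub_ne_zero.2 (hc v c hcv t ht)
      · simp only [pole_of_not_const hcol]
        exact continuousOn_const
    have hmeas : Measurable fun s : V → ℝ => ∏ v, deriv γ (s v) :=
      Finset.measurable_fun_prod _ fun v _ => (measurable_deriv γ).comp (measurable_pi_apply v)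
    refine ((hF.aestronglyMeasurable N.measurableSet_domain).mul
      hmeas.aestronglyMeasurable).congr ?_
    refine ae_restrict_of_forall_mem N.measurableSet_domain fun s hs => ?_
    simp only [Pi.mul_apply]
    rw [hint s hs]
    simp only [F, scalar, Finset.prod_mul_distrib, hlog _ (hs.1 _) _ (hs.1 _)]
    ring
  · refine ae_restrict_of_forall_mem N.measurableSet_domain fun s hs => ?_
    rw [hint s hs, norm_mul, norm_prod]
    have h1 : ∏ v, ‖N.scalar γ s v * pole (N.color v) (γ (s v))‖ ≤
        (∏ v, K v) * ∏ v, betaKernel ε (s v) := by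
      refine (Finset.prod_le_prod (fun v _ => norm_nonneg _) fun v _ => hK v s hs).trans ?_
      rw [Finset.prod_mul_distrib]
      exact mul_le_mul_of_nonneg_left (N.prod_weight_le hs hε hcard)
        (Finset.prod_nonneg fun v _ => hK0 v)
    have h2 : ∏ v, (Set.Ioo (0 : ℝ) 1).indicator (betaKernel ε) (s v) =
        ∏ v, betaKernel ε (s v) :=
      Finset.prod_congr rfl fun v _ => Set.indicator_of_mem (hs.1 v) _
    rw [h2]
    calc (∏ v, ‖N.scalar γ s v * pole (N.color v) (γ (s v))‖) * ‖f (P s)‖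
        ≤ ((∏ v, K v) * ∏ v, betaKernel ε (s v)) * ‖f‖ :=
          mul_le_mul h1 (f.norm_coe_le_norm _) (norm_nonneg _)
            (mul_nonneg (Finset.prod_nonneg fun v _ => hK0 v)
              (Finset.prod_nonneg fun v _ => betaKernel_nonneg (hs.1 v)))
      _ = _ := by ring

end PosTree

namespace PosTree

variable {r : ℕ} {V : Type u} (N : PosTree r V)

theorem par_ne {v : V} (hv : v ≠ N.root) : N.par v ≠ v := by
  obtain ⟨h, hh⟩ := N.exists_rank
  intro he
  have := hh v hv
  rw [he] at this
  exact lt_irrefl _ this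

variable [DecidableEq V]

/-- The tree without the vertex `v`, whose children become children of its parent. -/
def contract (v : V) (hv : v ≠ N.root) : PosTree r {x : V // x ≠ v} where
  root := ⟨N.root, hv.symm⟩
  par x := if h : N.par x = v then ⟨N.par v, N.par_ne hv⟩ else ⟨N.par x, h⟩
  color x := N.color x
  idx x := if N.par x = v then N.idx v + N.idx x else N.idx x
  par_root := by
    rw [dif_neg (by rw [N.par_root]; exact hv.symm)]
    exact Subtype.ext N.par_root
  idx_root := by
    rw [if_neg (by rw [N.par_root]; exact hv.symm), N.idx_root]
  idx_pos x := by
    split_ifs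
    · exact Nat.add_pos_left (N.idx_pos _) _
    · exact N.idx_pos _
  exists_rank := by
    obtain ⟨h, hh⟩ := N.exists_rank
    refine ⟨fun x => h x, fun x hx => ?_⟩
    have hx' : x.1 ≠ N.root := fun he => hx (Subtype.ext he)
    split_ifs with hp
    · have h1 := hh x hx'
      rw [hp] at h1
      exact (hh v hv).trans h1
    · exact hh x hx'

section Contract

variable {N} {v w : V}

omit [DecidableEq V] in
theorem par_of_children_eq (hw : N.children v = {w}) : w ≠ N.root ∧ N.par w = v := by
  have : w ∈ N.children v := by rw [hw]; rfl
  exact this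

omit [DecidableEq V] in
theorem ne_of_children_eq (hv : v ≠ N.root) (hw : N.children v = {w}) : w ≠ v := by
  rintro rfl
  exact N.par_ne hv (par_of_children_eq hw).2

omit [DecidableEq V] in
theorem par_eq_iff (hv : v ≠ N.root) (hw : N.children v = {w}) (x : V) : N.par x = v ↔ x = w := by
  constructor
  · intro h
    have hx : x ≠ N.root := by
      rintro rfl
      rw [N.par_root] at h
      exact hv h.symm
    have : x ∈ N.children v := ⟨hx, h⟩
    rwa [hw] at this
  · rintro rfl
    exact (par_of_children_eq hw).2

theorem contract_par_of_ne (hv : v ≠ N.root) (hw : N.children v = {w})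
    {x : {x : V // x ≠ v}} (hx : x.1 ≠ w) :
    ((N.contract v hv).par x).1 = N.par x := by
  simp only [contract]
  rw [dif_neg fun h => hx ((par_eq_iff hv hw _).1 h)]

theorem contract_par_child (hv : v ≠ N.root) (hw : N.children v = {w})
    (x : {x : V // x ≠ v}) (hx : x.1 = w) :
    ((N.contract v hv).par x).1 = N.par v := by
  simp only [contract]
  rw [dif_pos ((par_eq_iff hv hw _).2 hx)]

theorem ncard_children_contract (hv : v ≠ N.root) (hw : N.children v = {w})
    (x : {x : V // x ≠ v}) :
    ((N.contract v hv).children x).ncard = (N.children x).ncard := by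
  have hwr := (par_of_children_eq hw).1
  refine Set.ncard_congr (fun y _ => if y.1 = w then v else y.1) ?_ ?_ ?_
  · rintro y ⟨hy1, hy2⟩
    have hy1' : y.1 ≠ N.root := fun he => hy1 (Subtype.ext he)
    have hy3 := congrArg Subtype.val hy2
    by_cases hyw : y.1 = w
    · rw [contract_par_child hv hw y hyw] at hy3
      simp only [if_pos hyw]
      exact ⟨hv, hy3⟩
    · rw [contract_par_of_ne hv hw hyw] at hy3
      simp only [if_neg hyw]
      exact ⟨hy1', hy3⟩
  · rintro y z - - hyz
    split_ifs at hyz with h1 h2 h2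
    · exact Subtype.ext (h1.trans h2.symm)
    · exact absurd hyz.symm z.2
    · exact absurd hyz y.2
    · exact Subtype.ext hyz
  · rintro z ⟨hz1, hz2⟩
    by_cases hzv : z = v
    · refine ⟨⟨w, ne_of_children_eq hv hw⟩, ⟨fun he => hwr (congrArg Subtype.val he), ?_⟩, ?_⟩
      · apply Subtype.ext
        rw [contract_par_child hv hw _ rfl, ← hz2, hzv]
      · simp [hzv]
    · have hzw : z ≠ w := by
        rintro rfl
        exact x.2 (hz2.symm.trans (par_of_children_eq hw).2)
      refine ⟨⟨z, hzv⟩, ⟨fun he => hz1 (congrArg Subtype.val he), ?_⟩, ?_⟩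
      · apply Subtype.ext
        rw [contract_par_of_ne hv hw (x := ⟨z, hzv⟩) hzw, hz2]
      · simp [hzw]

/-- The point with coordinate `u` at `v` and the given other coordinates. -/
def insertAt (v : V) (y : {x : V // x ≠ v} → ℝ) (u : ℝ) : V → ℝ :=
  fun x => if h : x = v then u else y ⟨x, h⟩

@[simp]
theorem insertAt_self (y : {x : V // x ≠ v} → ℝ) (u : ℝ) : insertAt v y u v = u := dif_pos rfl

theorem insertAt_ne (y : {x : V // x ≠ v} → ℝ) (u : ℝ) {x : V} (h : x ≠ v) :
    insertAt v y u x = y ⟨x, h⟩ := dif_neg h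

theorem insertAt_mem_domain_iff (hv : v ≠ N.root) (hw : N.children v = {w})
    (y : {x : V // x ≠ v} → ℝ) (u : ℝ) :
    insertAt v y u ∈ N.domain ↔ y ∈ (N.contract v hv).domain ∧
      u ∈ Set.Ioo (y ⟨w, ne_of_children_eq hv hw⟩) (y ⟨N.par v, N.par_ne hv⟩) := by
  have hwv := ne_of_children_eq hv hw
  obtain ⟨hwr, hwp⟩ := par_of_children_eq hw
  constructor
  · rintro ⟨h1, h2⟩
    have hu2 := h2 v hv
    rw [insertAt_self, insertAt_ne y u (N.par_ne hv)] at hu2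
    have hu1 := h2 w hwr
    rw [hwp, insertAt_self, insertAt_ne y u hwv] at hu1
    refine ⟨⟨fun x => ?_, fun x hx => ?_⟩, hu1, hu2⟩
    · have := h1 x.1
      rwa [insertAt_ne y u x.2] at this
    · have hx' : x.1 ≠ N.root := fun he => hx (Subtype.ext he)
      by_cases hxw : x.1 = w
      · have e1 : (N.contract v hv).par x = ⟨N.par v, N.par_ne hv⟩ :=
          Subtype.ext (contract_par_child hv hw x hxw)
        have e2 : x = ⟨w, hwv⟩ := Subtype.ext hxw
        rw [e1, e2]
        exact hu1.trans hu2
      · have e1 := contract_par_of_ne hv hw hxw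
        have := h2 x.1 hx'
        rw [insertAt_ne y u x.2, ← e1, insertAt_ne y u ((N.contract v hv).par x).2] at this
        exact this
  · rintro ⟨⟨h1, h2⟩, hu1, hu2⟩
    refine ⟨fun x => ?_, fun x hx => ?_⟩
    · by_cases hxv : x = v
      · rw [hxv, insertAt_self]
        exact ⟨(h1 _).1.trans hu1, hu2.trans (h1 _).2⟩
      · rw [insertAt_ne y u hxv]
        exact h1 _
    · by_cases hxv : x = v
      · rw [hxv, insertAt_self, insertAt_ne y u (N.par_ne hv)]
        exact hu2
      · rw [insertAt_ne y u hxv]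
        by_cases hxw : x = w
        · subst hxw
          rw [hwp, insertAt_self]
          exact hu1
        · have e1 := contract_par_of_ne hv hw (x := ⟨x, hxv⟩) hxw
          have := h2 ⟨x, hxv⟩ fun he => hx (congrArg Subtype.val he)
          rw [show insertAt v y u (N.par x) = y ((N.contract v hv).par ⟨x, hxv⟩) by
            rw [← e1, insertAt_ne y u ((N.contract v hv).par ⟨x, hxv⟩).2]]
          exact this

variable {Γ : Type} [AddCommGroup Γ] [LinearOrder Γ] [IsOrderedAddMonoid Γ] [Fintype V]
  {γ : ℝ → ℂ} {p q : TangentialBasePoint} {M : Set ℂ}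

theorem exists_integrand_insertAt (hv : v ≠ N.root) (hw : N.children v = {w})
    (mon : (Fin r → ℤ) ≃+ Γ) (m : Fin r → ℤ)
    (hcol : N.color v = 0) (y : {x : V // x ≠ v} → ℝ) :
    ∃ R : ℂ, (N.contract v hv).integrand mon γ m y =
        ((((N.idx v - 1) + (N.idx w - 1) + 1).factorial : ℂ)⁻¹ *
          logDiff γ (y ⟨w, ne_of_children_eq hv hw⟩) (y ⟨N.par v, N.par_ne hv⟩) ^
            ((N.idx v - 1) + (N.idx w - 1) + 1)) * R ∧
      ∀ u, N.integrand mon γ m (insertAt v y u) =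
        ((((N.idx v - 1).factorial : ℂ)⁻¹ *
            logDiff γ u (y ⟨N.par v, N.par_ne hv⟩) ^ (N.idx v - 1)) *
          (((N.idx w - 1).factorial : ℂ)⁻¹ *
            logDiff γ (y ⟨w, ne_of_children_eq hv hw⟩) u ^ (N.idx w - 1)) *
          (deriv γ u / γ u)) * R := by
  have hwv := ne_of_children_eq hv hw
  obtain ⟨hwr, hwp⟩ := par_of_children_eq hw
  refine ⟨deriv γ (y ⟨w, hwv⟩) * (∏ x ∈ {(⟨w, hwv⟩ : {x : V // x ≠ v})}ᶜ,
    (N.contract v hv).scalar γ y x) *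
      (∏ x, fraction mon (γ (y x)) ((N.contract v hv).color x)).coeff (mon m), ?_, fun u => ?_⟩
  · rw [integrand_eq_mul, Fintype.prod_eq_mul_prod_compl (⟨w, hwv⟩ : {x : V // x ≠ v})]
    have h1 : (N.contract v hv).scalar γ y ⟨w, hwv⟩ =
        ((((N.idx v - 1) + (N.idx w - 1) + 1).factorial : ℂ)⁻¹ *
          logDiff γ (y ⟨w, hwv⟩) (y ⟨N.par v, N.par_ne hv⟩) ^
            ((N.idx v - 1) + (N.idx w - 1) + 1)) * deriv γ (y ⟨w, hwv⟩) := by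
      have e1 : (N.contract v hv).par ⟨w, hwv⟩ = ⟨N.par v, N.par_ne hv⟩ :=
        Subtype.ext (contract_par_child hv hw _ rfl)
      have e2 : (N.contract v hv).idx ⟨w, hwv⟩ - 1 = (N.idx v - 1) + (N.idx w - 1) + 1 := by
        have h1 := N.idx_pos v
        have h2 := N.idx_pos w
        simp only [contract, hwp, if_true]
        omega
      unfold scalar
      rw [e1, e2]
    rw [h1]
    ring
  · have hsub : ∀ {A : Type} [CommMonoid A] (f : V → A),
        ∏ x, f x = f v * ∏ x : {x : V // x ≠ v}, f x := by
      intro A _ f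
      rw [Fintype.prod_eq_mul_prod_compl v, Finset.prod_subtype (p := fun x => x ≠ v) _ (by simp)]
    rw [integrand_eq_mul, hsub (N.scalar γ (insertAt v y u)), hsub,
      Fintype.prod_eq_mul_prod_compl (⟨w, hwv⟩ : {x : V // x ≠ v})]
    have h1 : N.scalar γ (insertAt v y u) v = ((N.idx v - 1).factorial : ℂ)⁻¹ *
        logDiff γ u (y ⟨N.par v, N.par_ne hv⟩) ^ (N.idx v - 1) * deriv γ u := by
      unfold scalar
      rw [insertAt_self, insertAt_ne y u (N.par_ne hv)]
    have h2 : N.scalar γ (insertAt v y u) w = ((N.idx w - 1).factorial : ℂ)⁻¹ *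
        logDiff γ (y ⟨w, hwv⟩) u ^ (N.idx w - 1) * deriv γ (y ⟨w, hwv⟩) := by
      unfold scalar
      rw [hwp, insertAt_self, insertAt_ne y u hwv]
    have h3 : ∏ x ∈ {(⟨w, hwv⟩ : {x : V // x ≠ v})}ᶜ, N.scalar γ (insertAt v y u) x =
        ∏ x ∈ {(⟨w, hwv⟩ : {x : V // x ≠ v})}ᶜ, (N.contract v hv).scalar γ y x := by
      refine Finset.prod_congr rfl fun x hx => ?_
      have hxw : x.1 ≠ w := fun he => by simp [← he] at hx
      have e1 := contract_par_of_ne hv hw hxw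
      have e2 : (N.contract v hv).idx x = N.idx x := by
        simp only [contract]
        rw [if_neg fun h => hxw ((par_eq_iff hv hw _).1 h)]
      unfold scalar
      rw [e2, ← e1, insertAt_ne y u x.2, insertAt_ne y u ((N.contract v hv).par x).2]
    have h4 : ∏ x : {x : V // x ≠ v}, fraction mon (γ (insertAt v y u x)) (N.color x) =
        ∏ x, fraction mon (γ (y x)) ((N.contract v hv).color x) := by
      refine Finset.prod_congr rfl fun x _ => ?_
      rw [insertAt_ne y u x.2]
      rfl
    rw [h1, h2, h3, h4, hcol, fraction_zero, insertAt_self, HahnSeries.C_mul_eq_smul,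
      HahnSeries.coeff_smul, smul_eq_mul]
    ring

theorem integral_insertAt (hv : v ≠ N.root) (mon : (Fin r → ℤ) ≃+ Γ)
    (h : IsPathFromTo γ p q M)
    (h0 : ∀ t ∈ Set.Ioo (0 : ℝ) 1, γ t ≠ 0) (m : Fin r → ℤ)
    (hcol : N.color v = 0) (hw : N.children v = {w}) (y : {x : V // x ≠ v} → ℝ) :
    ∫ u, N.domain.indicator (N.integrand mon γ m) (insertAt v y u) =
      (N.contract v hv).domain.indicator ((N.contract v hv).integrand mon γ m) y := by
  have hmem := insertAt_mem_domain_iff hv hw y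
  by_cases hy : y ∈ (N.contract v hv).domain
  · obtain ⟨R, hR1, hR2⟩ := exists_integrand_insertAt (γ := γ) hv hw mon m hcol y
    have hwr := (par_of_children_eq hw).1
    have hlt : y ⟨w, ne_of_children_eq hv hw⟩ < y ⟨N.par v, N.par_ne hv⟩ := by
      have := hy.2 ⟨w, ne_of_children_eq hv hw⟩ fun he => hwr (congrArg Subtype.val he)
      rwa [show (N.contract v hv).par ⟨w, ne_of_children_eq hv hw⟩ = ⟨N.par v, N.par_ne hv⟩ from
        Subtype.ext (contract_par_child hv hw _ rfl)] at this
    rw [Set.indicator_of_mem hy, hR1,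
      ← h.integral_logDiff_pow h0 (hy.1 _).1 hlt (hy.1 _).2,
      ← intervalIntegral.integral_mul_const, intervalIntegral.integral_of_le hlt.le,
      integral_Ioc_eq_integral_Ioo, ← integral_indicator measurableSet_Ioo]
    congr 1
    ext u
    by_cases hu : u ∈ Set.Ioo (y ⟨w, ne_of_children_eq hv hw⟩) (y ⟨N.par v, N.par_ne hv⟩)
    · rw [Set.indicator_of_mem ((hmem u).2 ⟨hy, hu⟩), Set.indicator_of_mem hu, hR2]
    · rw [Set.indicator_of_notMem (fun hd => hu ((hmem u).1 hd).2), Set.indicator_of_notMem hu]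
  · rw [Set.indicator_of_notMem hy]
    simp only [Set.indicator_of_notMem (fun hd => hy ((hmem _).1 hd).1), integral_zero]

theorem exists_insertAt_measurableEquiv (v : V) :
    ∃ Ψ : (({x : V // x ≠ v} → ℝ) × ℝ) ≃ᵐ (V → ℝ), MeasurePreserving Ψ ∧
      ∀ y u, Ψ (y, u) = insertAt v y u := by
  let e₁ := MeasurableEquiv.piEquivPiSubtypeProd (fun _ : V => ℝ) (fun x => x ≠ v)
  have he₁ : MeasurePreserving e₁ := volume_preserving_piEquivPiSubtypeProd _ _
  let _ : Unique {x : V // ¬ x ≠ v} :=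
    { default := ⟨v, by simp⟩, uniq := fun x => Subtype.ext (not_not.1 x.2) }
  let e₂ := MeasurableEquiv.funUnique {x : V // ¬ x ≠ v} ℝ
  have he₂ : MeasurePreserving e₂ := by
    convert! volume_preserving_funUnique {x : V // ¬ x ≠ v} ℝ
  let Ψ := e₁.trans (MeasurableEquiv.prodCongr (MeasurableEquiv.refl _) e₂)
  have hΨ : MeasurePreserving Ψ := ((MeasurePreserving.id _).prod he₂).comp he₁
  refine ⟨Ψ.symm, hΨ.symm Ψ, fun y u => ?_⟩
  rw [MeasurableEquiv.symm_apply_eq]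
  refine Prod.ext (funext fun x => ?_) ?_
  · exact (insertAt_ne y u x.2).symm
  · exact (insertAt_self y u).symm

theorem contract_converges_and_integral_eq (hv : v ≠ N.root) (mon : (Fin r → ℤ) ≃+ Γ)
    (h : IsPathFromTo γ p q M)
    (h0 : ∀ t ∈ Set.Ioo (0 : ℝ) 1, γ t ≠ 0) (hN : N.Converges mon γ)
    (hcol : N.color v = 0) (hw : N.children v = {w}) :
    (N.contract v hv).Converges mon γ ∧
      N.integral mon γ = (N.contract v hv).integral mon γ := by
  obtain ⟨Ψ, hΨ, hΨv⟩ := exists_insertAt_measurableEquiv v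
  have hint : ∀ m, Integrable (fun z => N.domain.indicator (N.integrand mon γ m) (Ψ z)) :=
    fun m => hΨ.integrable_comp_of_integrable
      ((integrable_indicator_iff N.measurableSet_domain).2 (hN m))
  have hinner : ∀ m y, ∫ u, N.domain.indicator (N.integrand mon γ m) (Ψ (y, u)) =
      (N.contract v hv).domain.indicator ((N.contract v hv).integrand mon γ m) y := by
    intro m y
    simp only [hΨv]
    exact integral_insertAt hv mon h h0 m hcol hw y
  constructor
  · intro m
    rw [← integrable_indicator_iff (N.contract v hv).measurableSet_domain]
    have := (hint m).integral_prod_left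
    simpa only [hinner] using this
  · ext m
    unfold integral
    rw [← integral_indicator N.measurableSet_domain,
      ← integral_indicator (N.contract v hv).measurableSet_domain,
      ← hΨ.integral_comp Ψ.measurableEmbedding]
    rw [Measure.volume_eq_prod, integral_prod _ (hint m)]
    simp only [hinner]

end Contract

end PosTree

namespace PosTree

variable {r : ℕ}

/-- The conditions on a tree with positive indices that ensure convergence and survive the
contraction of vertices. -/
structure Admissible {V : Type u} (N : PosTree r V) (D : Set (LaurentPoly r)) (γ : ℝ → ℂ) :
    Prop where
  color_mem : ∀ v, N.color v ∈ insert 0 D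
  leaf : ∀ v, (N.children v).ncard = 0 → N.color v ≠ LaurentPoly.const r (γ 0)
  root_ne_source : N.color N.root ≠ LaurentPoly.const r (γ 0)
  root_ne_target : N.color N.root ≠ LaurentPoly.const r (γ 1)
  root_zero : N.color N.root = 0 → (N.children N.root).ncard = 1
  root_child : γ 0 = 0 → (N.children N.root).ncard ≠ 0

variable {Γ : Type} [AddCommGroup Γ] [LinearOrder Γ] [IsOrderedAddMonoid Γ]
  {γ : ℝ → ℂ} {p q : TangentialBasePoint} {D : Set (LaurentPoly r)}

theorem Admissible.contract {V : Type u} [DecidableEq V] {N : PosTree r V} (hN : N.Admissible D γ)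
    {v w : V} (hv : v ≠ N.root) (hw : N.children v = {w}) :
    (N.contract v hv).Admissible D γ where
  color_mem x := hN.color_mem x
  leaf x hx := hN.leaf x (by rwa [ncard_children_contract hv hw] at hx)
  root_ne_source := hN.root_ne_source
  root_ne_target := hN.root_ne_target
  root_zero h := by rw [ncard_children_contract hv hw]; exact hN.root_zero h
  root_child h := by rw [ncard_children_contract hv hw]; exact hN.root_child h

/-- The integral of an admissible tree does not change if all vertices of color zero with one child
are removed. -/
theorem Admissible.exists_reduced {M : Set ℂ} (mon : (Fin r → ℤ) ≃+ Γ) (h : IsPathFromTo γ p q M)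
    (h0 : ∀ t ∈ Set.Ioo (0 : ℝ) 1, γ t ≠ 0) {V : Type u} [Fintype V] (N : PosTree r V)
    (hN : N.Admissible D γ) (hc : N.Converges mon γ) :
    ∃ (W : Type u) (_ : Fintype W) (N' : PosTree r W), N'.Admissible D γ ∧ N'.Converges mon γ ∧
      N.integral mon γ = N'.integral mon γ ∧
      ∀ v, v ≠ N'.root → N'.color v = 0 → (N'.children v).ncard ≠ 1 := by
  induction hn : Fintype.card V using Nat.strong_induction_on generalizing V with
  | _ n ih =>
    classical
    by_cases hred : ∀ v, v ≠ N.root → N.color v = 0 → (N.children v).ncard ≠ 1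
    · exact ⟨V, inferInstance, N, hN, hc, rfl, hred⟩
    · push Not at hred
      obtain ⟨v, hv, hcol, hone⟩ := hred
      obtain ⟨w, hw⟩ := Set.ncard_eq_one.1 hone
      obtain ⟨hc', hI⟩ := contract_converges_and_integral_eq hv mon h h0 hc hcol hw
      obtain ⟨W, iW, N', h1, h2, h3, h4⟩ := ih (Fintype.card {x : V // x ≠ v})
        (hn ▸ Fintype.card_subtype_lt (x := v) (by simp)) (N.contract v hv) (hN.contract hv hw)
        hc' rfl
      exact ⟨W, iW, N', h1, h2, hI.trans h3, h4⟩

section Hub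

variable {V : Type u} (N : PosTree r V)

/-- The vertices of non-zero color that get a new child of color zero: those with several children
and the root if it has none. -/
def NeedsHub (v : V) : Prop :=
  N.color v ≠ 0 ∧ (2 ≤ (N.children v).ncard ∨ v = N.root ∧ (N.children v).ncard = 0)

/-- A vertex or the new child of a vertex. -/
abbrev HubVertex : Type u := V ⊕ {v : V // N.NeedsHub v}

open Classical in
/-- The parent function after the insertion of the new children. -/
def hubPar : N.HubVertex → N.HubVertex
  | .inl v => if h : N.NeedsHub (N.par v) then .inr ⟨N.par v, h⟩ else .inl (N.par v)
  | .inr v => .inl v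

/-- A function that decreases along `hubPar`. -/
def hubRank : N.HubVertex → ℕ
  | .inl v => 2 * N.exists_rank.choose v
  | .inr v => 2 * N.exists_rank.choose v + 1

/-- The new children have color zero. -/
def hubColor : N.HubVertex → LaurentPoly r := Sum.elim N.color fun _ => 0

/-- The edges to the new children have index zero. -/
def hubIdx : N.HubVertex → ℕ := Sum.elim N.idx fun _ => 0

theorem hubRank_hubPar_lt (v : N.HubVertex) (hv : v ≠ .inl N.root) :
    N.hubRank (N.hubPar v) < N.hubRank v := by
  rcases v with v | v
  · have hv' : v ≠ N.root := fun h => hv (by rw [h])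
    have := N.exists_rank.choose_spec v hv'
    unfold hubPar
    dsimp only
    split_ifs <;> simp only [hubRank] <;> omega
  · simp [hubPar, hubRank]

variable [Fintype V] {N} (hN : N.Admissible D γ)

omit [Fintype V] in
theorem Admissible.hubColor_mem (hN : N.Admissible D γ) (v : N.HubVertex) :
    N.hubColor v ∈ insert 0 D := by
  rcases v with v | v
  · exact hN.color_mem v
  · exact Set.mem_insert _ _

open Classical in
/-- The colored tree with the new children. -/
abbrev Admissible.hubTree : ColoredTree.{u} (insert 0 D) :=
  ColoredTree.ofParent N.hubRank N.hubRank_hubPar_lt N.hubColor hN.hubColor_mem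

open Classical in
/-- The index on the tree with the new children. -/
abbrev Admissible.hubIndex : hN.hubTree.Index :=
  ColoredTree.indexOfParent N.hubRank N.hubRank_hubPar_lt N.hubColor hN.hubColor_mem N.hubIdx

open Classical in
theorem Admissible.hubTree_parent {v : N.HubVertex} (hv : v ≠ .inl N.root) :
    hN.hubTree.parent v = N.hubPar v :=
  ColoredTree.parent_ofParent _ _ _ _ hv

open Classical in
theorem Admissible.hubIndex_at (v : N.HubVertex) : hN.hubIndex.at v = N.hubIdx v := by
  by_cases hv : v = .inl N.root
  · rw [hv]
    exact (ColoredTree.Index.at_root hN.hubIndex).trans N.idx_root.symm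
  · exact ColoredTree.at_indexOfParent _ _ _ _ _ hv

theorem Admissible.hubIndex_pos (v : V) : 0 < hN.hubIndex.at (.inl v : N.HubVertex) := by
  rw [hN.hubIndex_at]
  exact N.idx_pos v

theorem Admissible.carrier_inl (v : V) :
    ColoredTree.carrier hN.hubIndex (.inl v : N.HubVertex) = ⟨.inl v, hN.hubIndex_pos v⟩ :=
  ColoredTree.carrier_of_pos _ _

theorem Admissible.carrier_inr (v : {v : V // N.NeedsHub v}) :
    ColoredTree.carrier hN.hubIndex (.inr v : N.HubVertex) = ⟨.inl v.1, hN.hubIndex_pos v⟩ := by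
  have h1 : hN.hubTree.parent (.inr v : N.HubVertex) = (.inl v.1 : N.HubVertex) :=
    hN.hubTree_parent (by simp)
  have h2 : hN.hubIndex.at (.inr v : N.HubVertex) = 0 := hN.hubIndex_at _
  rw [← ColoredTree.carrier_parent hN.hubIndex h2, h1, hN.carrier_inl]

/-- The variables of integration correspond to the old vertices. -/
def Admissible.freeEquiv : ColoredTree.FreeVertex hN.hubIndex ≃ V :=
  (Equiv.ofBijective (fun v : V =>
    (⟨.inl v, hN.hubIndex_pos v⟩ : ColoredTree.FreeVertex hN.hubIndex)) (by
    constructor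
    · intro v w h
      exact Sum.inl_injective (congrArg Subtype.val h)
    · rintro ⟨v | v, hv⟩
      · exact ⟨v, rfl⟩
      · rw [hN.hubIndex_at] at hv
        exact absurd hv (lt_irrefl 0))).symm

theorem Admissible.freeEquiv_inl (v : V) : hN.freeEquiv ⟨.inl v, hN.hubIndex_pos v⟩ = v :=
  Equiv.ofBijective_symm_apply_apply _ _ v

theorem Admissible.isContraction_hubTree :
    ColoredTree.IsContraction hN.hubIndex N hN.freeEquiv where
  root := by
    rw [ColoredTree.carrier_root]
    exact hN.freeEquiv_inl _
  par v := by
    obtain ⟨x, rfl⟩ := hN.freeEquiv.symm.surjective v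
    change N.par (hN.freeEquiv ⟨.inl x, hN.hubIndex_pos x⟩) =
      hN.freeEquiv (ColoredTree.carrier hN.hubIndex (hN.hubTree.parent (.inl x : N.HubVertex)))
    rw [hN.freeEquiv_inl]
    by_cases hx : x = N.root
    · have h1 : hN.hubTree.parent (.inl x : N.HubVertex) = (.inl x : N.HubVertex) := by
        rw [hx]
        exact hN.hubTree.parent_root
      rw [h1, hN.carrier_inl, hN.freeEquiv_inl, hx, N.par_root]
    · rw [hN.hubTree_parent (by simpa using hx)]
      unfold hubPar
      dsimp only
      split_ifs
      · rw [hN.carrier_inr, hN.freeEquiv_inl]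
      · rw [hN.carrier_inl, hN.freeEquiv_inl]
  idx v := by
    obtain ⟨x, rfl⟩ := hN.freeEquiv.symm.surjective v
    change N.idx (hN.freeEquiv ⟨.inl x, hN.hubIndex_pos x⟩) = hN.hubIndex.at (.inl x : N.HubVertex)
    rw [hN.freeEquiv_inl, hN.hubIndex_at]
    rfl
  color_eq x hx := by
    rcases x with x | x
    · rw [hN.carrier_inl, hN.freeEquiv_inl]
      rfl
    · exact absurd rfl hx
  unique x y hx hy h := by
    rcases x with x | x
    · rcases y with y | y
      · rw [hN.carrier_inl, hN.carrier_inl] at h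
        exact congrArg Subtype.val h
      · exact absurd rfl hy
    · exact absurd rfl hx
  exists_color v hv := by
    obtain ⟨x, rfl⟩ := hN.freeEquiv.symm.surjective v
    refine ⟨(.inl x : N.HubVertex), hN.carrier_inl x, ?_⟩
    rwa [Equiv.apply_symm_apply] at hv

theorem Admissible.children_inl_of_needsHub {v : V} (hv : N.NeedsHub v) :
    hN.hubTree.children (.inl v : N.HubVertex) = {(.inr ⟨v, hv⟩ : N.HubVertex)} := by
  ext x
  constructor
  · rintro ⟨hx1, hx2⟩
    rw [hN.hubTree_parent hx1] at hx2
    rcases x with x | x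
    · unfold hubPar at hx2
      dsimp only at hx2
      split_ifs at hx2 with h
      exact absurd (Sum.inl_injective hx2 ▸ hv) h
    · have : x.1 = v := Sum.inl_injective hx2
      exact congrArg Sum.inr (Subtype.ext this)
  · rintro rfl
    exact ⟨by simp, hN.hubTree_parent (by simp)⟩

theorem Admissible.children_inl_of_not_needsHub {v : V} (hv : ¬ N.NeedsHub v) :
    hN.hubTree.children (.inl v : N.HubVertex) = (Sum.inl '' N.children v : Set N.HubVertex) := by
  ext x
  constructor
  · rintro ⟨hx1, hx2⟩
    rw [hN.hubTree_parent hx1] at hx2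
    rcases x with x | x
    · unfold hubPar at hx2
      dsimp only at hx2
      split_ifs at hx2 with h
      exact ⟨x, ⟨fun h => hx1 (by rw [h]), Sum.inl_injective hx2⟩, rfl⟩
    · have : x.1 = v := Sum.inl_injective hx2
      exact absurd (this ▸ x.2) hv
  · rintro ⟨x, ⟨hx1, rfl⟩, rfl⟩
    have hx : (.inl x : N.HubVertex) ≠ .inl N.root := by simpa using hx1
    refine ⟨hx, ?_⟩
    rw [hN.hubTree_parent hx]
    unfold hubPar
    exact dif_neg hv

theorem Admissible.children_inr (v : {v : V // N.NeedsHub v}) :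
    hN.hubTree.children (.inr v : N.HubVertex) = (Sum.inl '' N.children v.1 : Set N.HubVertex) := by
  ext x
  constructor
  · rintro ⟨hx1, hx2⟩
    rw [hN.hubTree_parent hx1] at hx2
    rcases x with x | x
    · unfold hubPar at hx2
      dsimp only at hx2
      split_ifs at hx2 with h
      refine ⟨x, ⟨fun h => hx1 (by rw [h]), ?_⟩, rfl⟩
      exact congrArg Subtype.val (Sum.inr_injective hx2)
    · cases hx2
  · rintro ⟨x, ⟨hx1, hx2⟩, rfl⟩
    have hx : (.inl x : N.HubVertex) ≠ .inl N.root := by simpa using hx1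
    refine ⟨hx, ?_⟩
    rw [hN.hubTree_parent hx]
    unfold hubPar
    dsimp only
    rw [dif_pos (by rw [hx2]; exact v.2)]
    exact congrArg Sum.inr (Subtype.ext hx2)

theorem Admissible.ncard_children_inl (v : V) :
    N.NeedsHub v ∧ (hN.hubTree.children (.inl v : N.HubVertex)).ncard = 1 ∨
      ¬ N.NeedsHub v ∧
        (hN.hubTree.children (.inl v : N.HubVertex)).ncard = (N.children v).ncard := by
  by_cases hv : N.NeedsHub v
  · exact Or.inl ⟨hv, by rw [hN.children_inl_of_needsHub hv]; exact Set.ncard_singleton _⟩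
  · exact Or.inr ⟨hv, by
      rw [hN.children_inl_of_not_needsHub hv]
      exact Set.ncard_image_of_injective _ Sum.inl_injective⟩

theorem Admissible.ncard_children_inr (v : {v : V // N.NeedsHub v}) :
    (hN.hubTree.children (.inr v : N.HubVertex)).ncard = (N.children v.1).ncard := by
  rw [hN.children_inr v]
  exact Set.ncard_image_of_injective _ Sum.inl_injective

theorem Admissible.harvestable_hubTree
    (hred : ∀ v, v ≠ N.root → N.color v = 0 → (N.children v).ncard ≠ 1) :
    ColoredTree.Harvestable γ hN.hubIndex := by
  have hrt : hN.hubTree.root = (.inl N.root : N.HubVertex) := rfl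
  have hdeg_inr : ∀ v : {v : V // N.NeedsHub v},
      hN.hubTree.deg (.inr v : N.HubVertex) = (N.children v.1).ncard + 1 := by
    intro v
    rw [← hN.ncard_children_inr]
    exact hN.hubTree.deg_of_ne_root (by rw [hrt]; simp)
  have hdeg_inl : ∀ v, v ≠ N.root → hN.hubTree.deg (.inl v : N.HubVertex) =
      (hN.hubTree.children (.inl v : N.HubVertex)).ncard + 1 := by
    intro v hv
    exact hN.hubTree.deg_of_ne_root (by rw [hrt]; simpa using hv)
  have hdeg_root : hN.hubTree.deg (.inl N.root : N.HubVertex) = 1 := by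
    have h1 : hN.hubTree.deg (.inl N.root : N.HubVertex) =
        (hN.hubTree.children (.inl N.root : N.HubVertex)).ncard := hN.hubTree.deg_root
    rw [h1]
    rcases hN.ncard_children_inl N.root with ⟨-, h⟩ | ⟨hn, h⟩
    · exact h
    · rw [h]
      by_cases hc : N.color N.root = 0
      · exact hN.root_zero hc
      · unfold NeedsHub at hn
        simp only [ne_eq, hc, not_false_eq_true, true_and, not_or] at hn
        omega
  refine ⟨⟨?_, hN.root_ne_source, hN.root_ne_target⟩, hdeg_root, ?_, ?_, ?_⟩
  · rintro (v | v) hv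
    · have hvr : v ≠ N.root := by
        rintro rfl
        exact hN.root_ne_source hv
      have hne : (N.children v).ncard ≠ 0 := fun h => hN.leaf v h hv
      rw [hdeg_inl v hvr]
      rcases hN.ncard_children_inl v with ⟨-, h⟩ | ⟨-, h⟩ <;> omega
    · have h0 : γ 0 = 0 := by
        apply const_injective r
        rw [← hv, LaurentPoly.const, map_zero]
        rfl
      rw [hdeg_inr]
      rcases v.2.2 with h | ⟨h1, h2⟩
      · omega
      · rw [h1] at h2
        exact absurd h2 (hN.root_child h0)
  · rintro (v | v) hv
    · by_cases hvr : v = N.root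
      · rw [hvr, hdeg_root]; omega
      · rw [hdeg_inl v hvr]
        rcases hN.ncard_children_inl v with ⟨-, h⟩ | ⟨hn, h⟩
        · omega
        · have hv' : N.color v ≠ 0 := hv
          unfold NeedsHub at hn
          simp only [ne_eq, hv', not_false_eq_true, true_and, not_or] at hn
          omega
    · exact absurd rfl hv
  · rintro (v | v) hv
    · by_cases hvr : v = N.root
      · rw [hvr, hdeg_root]; omega
      · rw [hdeg_inl v hvr]
        have hv' : N.color v = 0 := hv
        rcases hN.ncard_children_inl v with ⟨hn, -⟩ | ⟨-, h⟩
        · exact absurd hv' hn.1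
        · have := hred v hvr hv'
          omega
    · rw [hdeg_inr]
      rcases v.2.2 with h | ⟨-, h⟩ <;> omega
  · rintro (v | v) hv
    · exact absurd hv (hN.hubIndex_pos v).ne'
    · refine ⟨rfl, ?_⟩
      have h1 : hN.hubTree.parent (.inr v : N.HubVertex) = (.inl v.1 : N.HubVertex) :=
        hN.hubTree_parent (by simp)
      rw [h1]
      exact v.2.1

end Hub

end PosTree

namespace ColoredTree

variable {r : ℕ} {D : Set (LaurentPoly r)} {X : ColoredTree.{u} D}

open Classical in
/-- The tree with positive indices that arises by contracting the edges of index zero. -/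
def contractZero (k : X.Index) : PosTree r (FreeVertex k) where
  root := carrier k X.root
  par v := carrier k (X.parent v)
  color v := if h : ∃ x, carrier k x = v ∧ X.color x ≠ 0 then X.color h.choose else 0
  idx v := k.at v
  par_root := by
    rw [carrier_root, X.parent_root, carrier_root]
  idx_root := by
    rw [carrier_root, Index.at_root]
  idx_pos v := v.2
  exists_rank := by
    refine ⟨fun v => X.graph.dist v.1 X.root, fun v hv => ?_⟩
    refine (dist_carrier_le k _).trans_lt (X.dist_parent_lt fun h => hv ?_)
    rw [carrier_root]
    exact Subtype.ext h

variable {k : X.Index}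

theorem exists_of_contractZero_color_ne_zero {v : FreeVertex k}
    (h : (contractZero k).color v ≠ 0) :
    ∃ x, carrier k x = v ∧ X.color x ≠ 0 ∧ (contractZero k).color v = X.color x := by
  have hex : ∃ x, carrier k x = v ∧ X.color x ≠ 0 := by
    by_contra hn
    exact h (dif_neg hn)
  exact ⟨hex.choose, hex.choose_spec.1, hex.choose_spec.2, dif_pos hex⟩

theorem isContraction_contractZero (hk : k.EssentiallyPositive) :
    IsContraction k (contractZero k) (Equiv.refl _) where
  root := rfl
  par _ := rfl
  idx _ := rfl
  color_eq x hx := by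
    have hex : ∃ y, carrier k y = carrier k x ∧ X.color y ≠ 0 := ⟨x, rfl, hx⟩
    have h1 : (contractZero k).color (carrier k x) = X.color hex.choose := dif_pos hex
    rw [Equiv.refl_apply, h1, hk.eq_of_carrier_eq hex.choose_spec.2 hx hex.choose_spec.1]
  unique _ _ hx hy h := hk.eq_of_carrier_eq hx hy h
  exists_color v hv := by
    obtain ⟨x, h1, h2, -⟩ := exists_of_contractZero_color_ne_zero hv
    exact ⟨x, h1, h2⟩

theorem mem_children_contractZero {v w : FreeVertex k} :
    w ∈ (contractZero k).children v ↔ w.1 ≠ X.root ∧ carrier k (X.parent w) = v := by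
  have : w ≠ (contractZero k).root ↔ w.1 ≠ X.root := by
    change w ≠ carrier k X.root ↔ _
    rw [carrier_root, ne_eq, Subtype.ext_iff]
  exact and_congr_left' this

theorem nonempty_children_of_one_lt_deg {v : X.V} (h : 1 < X.deg v) : (X.children v).Nonempty := by
  apply Set.nonempty_of_ncard_ne_zero
  by_cases hv : v = X.root
  · rw [hv, X.deg_root] at h
    rw [hv]
    omega
  · rw [X.deg_of_ne_root hv] at h
    omega

/-- If all edges at the root have positive index, no other vertex is merged with the root. -/
theorem eq_root_of_carrier_eq (h : ∀ w, X.graph.Adj w X.root → 0 < k.at w) {x : X.V}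
    (hx : carrier k x = carrier k X.root) : x = X.root := by
  induction hd : X.graph.dist x X.root using Nat.strong_induction_on generalizing x with
  | _ d ih =>
    by_cases h0 : 0 < k.at x
    · rw [carrier_of_pos k h0, carrier_root] at hx
      exact congrArg Subtype.val hx
    · have h0' : k.at x = 0 := by omega
      have hr := ne_root_of_at_eq_zero k h0'
      have hp := ih _ (hd ▸ X.dist_parent_lt hr) ((carrier_parent k h0').trans hx) rfl
      have := X.adj_parent hr
      rw [hp] at this
      exact absurd (h x this) h0

theorem contractZero_color_root (hk : k.EssentiallyPositive)
    (hroot : X.color X.root = 0 → ∀ w, X.graph.Adj w X.root → 0 < k.at w) :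
    (contractZero k).color (contractZero k).root = X.color X.root := by
  by_cases h : X.color X.root = 0
  · rw [h]
    by_contra hne
    obtain ⟨x, h1, h2, -⟩ := exists_of_contractZero_color_ne_zero hne
    rw [eq_root_of_carrier_eq (hroot h) h1] at h2
    exact h2 h
  · exact (isContraction_contractZero hk).color_eq _ h

theorem admissible_contractZero {γ : ℝ → ℂ} (hX : X.Admissible γ) (hk : k.EssentiallyPositive)
    (hroot : X.color X.root = 0 → X.deg X.root = 1 ∧ ∀ w, X.graph.Adj w X.root → 0 < k.at w)
    (hsingle : γ 0 = 0 → Nontrivial X.V)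
    (hconv : γ 0 ≠ 0 → ∀ v, X.color v = LaurentPoly.const r (γ 0) →
      ∃ w, w ≠ X.root ∧ 0 < k.at w ∧ carrier k (X.parent w) = carrier k v) :
    (contractZero k).Admissible D γ := by
  have hcr := contractZero_color_root hk fun h => (hroot h).2
  have hzero : (contractZero k).color (contractZero k).root = 0 →
      ((contractZero k).children (contractZero k).root).ncard = 1 := by
    intro h
    rw [hcr] at h
    obtain ⟨hdeg, hpos⟩ := hroot h
    rw [X.deg_root] at hdeg
    obtain ⟨w, hw⟩ := Set.ncard_eq_one.1 hdeg
    have hwm : w ∈ X.children X.root := by rw [hw]; rfl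
    have hadj := X.adj_parent hwm.1
    rw [hwm.2] at hadj
    rw [Set.ncard_eq_one]
    refine ⟨⟨w, hpos w hadj⟩, Set.ext fun g => ?_⟩
    rw [mem_children_contractZero]
    constructor
    · rintro ⟨h1, h2⟩
      have : g.1 ∈ X.children X.root := ⟨h1, eq_root_of_carrier_eq hpos h2⟩
      rw [hw] at this
      exact Subtype.ext this
    · rintro rfl
      exact ⟨hwm.1, by rw [hwm.2]; rfl⟩
  have hconst0 : γ 0 = 0 → LaurentPoly.const r (γ 0) = 0 := fun h => by
    rw [h, LaurentPoly.const, map_zero]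
  refine ⟨fun v => ?_, fun v hv hcol => ?_, ?_, ?_, hzero, fun h0 hempty => ?_⟩
  · by_cases h : (contractZero k).color v = 0
    · exact Or.inl h
    · obtain ⟨x, -, -, h3⟩ := exists_of_contractZero_color_ne_zero h
      rw [h3]
      exact Or.inr (X.color_mem x)
  · rw [Set.ncard_eq_zero] at hv
    by_cases h0 : γ 0 = 0
    · rw [hconst0 h0] at hcol
      let S : Set X.V := {x | carrier k x = v}
      have hS : S.Nonempty := ⟨v.1, carrier_of_pos k v.2⟩
      obtain ⟨x, hx, hmax⟩ := S.toFinite.exists_maximalFor (fun x => X.graph.dist x X.root) S hS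
      have hxc : X.color x = 0 := by
        by_contra hne
        have := (isContraction_contractZero hk).color_eq x hne
        rw [Equiv.refl_apply, show carrier k x = v from hx, hcol] at this
        exact hne this.symm
      obtain ⟨y, hy1, hy2⟩ :=
        nonempty_children_of_one_lt_deg (hX.1 x (by rw [hxc, hconst0 h0]))
      by_cases hy0 : k.at y = 0
      · have hyS : y ∈ S := by
          change carrier k y = v
          rw [← carrier_parent k hy0, hy2]
          exact hx
        have h1 := X.dist_parent_lt hy1
        rw [hy2] at h1
        exact absurd (hmax hyS h1.le) (not_le.2 h1)
      · have : (⟨y, Nat.pos_of_ne_zero hy0⟩ : FreeVertex k) ∈ (contractZero k).children v :=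
          mem_children_contractZero.2 ⟨hy1, by rw [hy2]; exact hx⟩
        rw [hv] at this
        exact this
    · have hne : (contractZero k).color v ≠ 0 := by
        rw [hcol]
        intro h
        exact h0 (const_injective r (by rw [h, LaurentPoly.const, map_zero]))
      obtain ⟨x, h1, -, h3⟩ := exists_of_contractZero_color_ne_zero hne
      obtain ⟨w, hw1, hw2, hw3⟩ := hconv h0 x (by rw [← h3, hcol])
      have : (⟨w, hw2⟩ : FreeVertex k) ∈ (contractZero k).children v :=
        mem_children_contractZero.2 ⟨hw1, by rw [hw3, h1]⟩
      rw [hv] at this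
      exact this
  · rw [hcr]; exact hX.2.1
  · rw [hcr]; exact hX.2.2
  · have hcr0 : X.color X.root ≠ 0 := by
      intro h
      rw [hzero (hcr.trans h)] at hempty
      exact one_ne_zero hempty
    rw [Set.ncard_eq_zero] at hempty
    have hall : ∀ x, carrier k x = carrier k X.root := by
      intro x
      induction hd : X.graph.dist x X.root using Nat.strong_induction_on generalizing x with
      | _ d ih =>
        by_cases hx : x = X.root
        · rw [hx]
        · have hp := ih _ (hd ▸ X.dist_parent_lt hx) (X.parent x) rfl
          by_cases hx0 : k.at x = 0
          · rw [← carrier_parent k hx0, hp]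
          · have : (⟨x, Nat.pos_of_ne_zero hx0⟩ : FreeVertex k) ∈
                (contractZero k).children (contractZero k).root :=
              mem_children_contractZero.2 ⟨hx, hp⟩
            rw [hempty] at this
            exact absurd this (Set.notMem_empty _)
    have := hsingle h0
    obtain ⟨x, hmax⟩ := Finite.exists_max fun x => X.graph.dist x X.root
    have hx : x ≠ X.root := by
      rintro rfl
      obtain ⟨y, hy⟩ := exists_ne X.root
      have h1 := hmax y
      have h2 := X.dist_parent_lt hy
      rw [SimpleGraph.dist_self] at h1
      omega
    have hxc : X.color x ≠ 0 := by
      intro hc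
      obtain ⟨y, hy1, hy2⟩ :=
        nonempty_children_of_one_lt_deg (hX.1 x (by rw [hc, hconst0 h0]))
      have h1 := hmax y
      have h2 := X.dist_parent_lt hy1
      rw [hy2] at h2
      omega
    exact hx (hk.eq_of_carrier_eq hxc hcr0 (hall x))

end ColoredTree

end TreeIntegral

end

theorem mainTheorem7 {r : ℕ} {Γ : Type} [AddCommGroup Γ] [LinearOrder Γ] [IsOrderedAddMonoid Γ]
    (mon : (Fin r → ℤ) ≃+ Γ)
    (D : Set (TreeIntegral.LaurentPoly r)) (hD : D.Finite)
    (γ : ℝ → ℂ)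
    (hγ : TreeIntegral.IsPathOn γ (TreeIntegral.complexCompl (insert 0 D)))
    (hreg : ∀ a ∈ D, (∀ c, a ≠ TreeIntegral.LaurentPoly.const r c) →
      TreeIntegral.RegularAlong mon γ a)
    (X : TreeIntegral.ColoredTree.{u} D) (hX : X.Admissible γ)
    (k : X.Index) (hk : k.EssentiallyPositive)
    (hroot : X.color X.root = 0 → X.deg X.root = 1 ∧ ∀ w, X.graph.Adj w X.root → 0 < k.at w)
    (hsingle : γ 0 = 0 → Nontrivial X.V)
    (hconv : γ 0 ≠ 0 → ∀ v, X.color v = TreeIntegral.LaurentPoly.const r (γ 0) →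
      ∃ w, w ≠ X.root ∧ 0 < k.at w ∧
        TreeIntegral.ColoredTree.carrier k (X.parent w) = TreeIntegral.ColoredTree.carrier k v) :
    TreeIntegral.ColoredTree.Converges mon γ k ∧
    ∃ (Y : TreeIntegral.ColoredTree.{u} (insert 0 D)) (l : Y.Index),
      TreeIntegral.ColoredTree.Harvestable γ l ∧
      TreeIntegral.ColoredTree.Converges mon γ l ∧
      TreeIntegral.ColoredTree.iteratedIntegral mon γ k =
        TreeIntegral.ColoredTree.iteratedIntegral mon γ l := by
  obtain ⟨p, q, hpath⟩ := hγ
  have hcol : ∀ c, TreeIntegral.LaurentPoly.const r c ∈ insert 0 D →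
      ∀ t ∈ Set.Ioo (0 : ℝ) 1, γ t ≠ c := by
    rintro c hc t ht rfl
    exact hpath.mem t ht hc
  have h0 : ∀ t ∈ Set.Ioo (0 : ℝ) 1, γ t ≠ 0 :=
    hcol 0 (by rw [TreeIntegral.LaurentPoly.const, map_zero]; exact Set.mem_insert _ _)
  have hadm := TreeIntegral.ColoredTree.admissible_contractZero hX hk hroot hsingle hconv
  have hcontr := TreeIntegral.ColoredTree.isContraction_contractZero hk
  have hconvN : (TreeIntegral.ColoredTree.contractZero k).Converges mon γ := by
    refine TreeIntegral.PosTree.converges _ mon hpath h0 (fun v hv => ?_) (fun v c hc => ?_)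
      (fun v hv => hadm.leaf v (by rw [hv, Set.ncard_empty])) hadm.root_ne_target
    · rcases hadm.color_mem v with h | h
      · exact absurd (h.trans (map_zero (algebraMap ℂ (TreeIntegral.LaurentPoly r))).symm) (hv 0)
      · exact hreg _ h hv
    · exact hcol c (hc ▸ hadm.color_mem v)
  obtain ⟨W, iW, N, hN, hNc, hI, hred⟩ := hadm.exists_reduced mon hpath h0 _ hconvN
  have hhub := hN.isContraction_hubTree
  exact ⟨(hcontr.converges_iff mon γ h0).2 hconvN, hN.hubTree, hN.hubIndex,
    hN.harvestable_hubTree hred, (hhub.converges_iff mon γ h0).2 hNc,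
    (hcontr.iteratedIntegral_eq mon γ h0).trans
      (hI.trans (hhub.iteratedIntegral_eq mon γ h0).symm)⟩
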